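/- A matroid $M$ on a finite set $S$ is \emph{strongly base orderable} if for every pair of bases $I,J$ there is a bijection $\pi\colon I\to J$ such that $\pi(K)\cup(I\setminus K)$ is a base for every $K\subseteq I$. Given a matroid $M$ on $S$ and a loopless graph $G=(S,E)$ (parallel edges allowed), a matching $F\subseteq E$ is \emph{feasible} if the set $\bigcup F$ of vertices covered by $F$ is independent in $M$. The \emph{weighted matroid matching problem} asks, for given weights $w\colon E\to\mathbb{R}_{\ge 0}$, for a feasible matching of maximum total weight; the \emph{unweighted} problem asks for a feasible matching with the maximum number of edges. The matroid is accessible only through an independence oracle, which answers in one step whether a given subset of $S$ is independent. The graph is given as a list of edges. \textbf{Theorem.} There is a polynomial time approximation scheme for both the weighted and the unweighted matroid matching problem on strongly base orderable matroids. That is: (i) for every $\varepsilon>0$ there are a deterministic random access program and a polynomial $p$ such that, for every strongly base orderable matroid $M$ on a finite set $S$, every graph $G=(S,E)$ and every $w\colon E\to\mathbb{R}_{\ge 0}$, the program halts after at most $p(|S|+|E|)$ steps and outputs a feasible matching $F$ with $w(B)\le(1+\varepsilon)\,w(F)$ for every feasible matching $B$; (ii) for every $\varepsilon>0$ there are a deterministic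 random access program and a polynomial $p$ such that, for every strongly base orderable matroid $M$ on a finite set $S$ and every graph $G=(S,E)$, the program, which receives no weights, halts after at most $p(|S|+|E|)$ steps and outputs a feasible matching $F$ with $|B|\le(1+\varepsilon)\,|F|$ for every feasible matching $B$. Here a step is an oracle call, a memory access, the loading of a constant, an addition, a subtraction or a comparison of integers or of real numbers (weights), or a control step. -/

import Mathlib

/-! ### Matroids and the matching problem -/

/-- A matroid is strongly base orderable if any two bases `I`, `J` admit a bijection `π : I → J`
such that `π(K) ∪ (I \ K)` is a base for every `K ⊆ I`. -/
def Matroid.StronglyBaseOrderable {α : Type*} (M : Matroid α) : Prop :=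
  ∀ I J : Set α, M.IsBase I → M.IsBase J →
    ∃ π : α → α, Set.BijOn π I J ∧ ∀ K : Set α, K ⊆ I → M.IsBase (π '' K ∪ (I \ K))

/-- A matroid `M` and a graph on the same finite set of `numElts` elements. The graph is given by
its list of `numEdges` edges; the edge `e` joins the distinct vertices `fst e` and `snd e`.
Parallel edges are allowed. -/
structure MatchingInstance where
  numElts : ℕ
  numEdges : ℕ
  M : Matroid (Fin numElts)
  ground_eq : M.E = Set.univ
  fst : Fin numEdges → Fin numElts
  snd : Fin numEdges → Fin numElts
  fst_ne_snd : ∀ e, fst e ≠ snd e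

namespace MatchingInstance

/-- The two endpoints of an edge. -/
def ends (I : MatchingInstance) (e : Fin I.numEdges) : Finset (Fin I.numElts) :=
  {I.fst e, I.snd e}

/-- The set of vertices covered by a set of edges. -/
def covered (I : MatchingInstance) (F : Finset (Fin I.numEdges)) : Finset (Fin I.numElts) :=
  F.biUnion I.ends

/-- No two distinct edges of `F` share a vertex. -/
def IsMatching (I : MatchingInstance) (F : Finset (Fin I.numEdges)) : Prop :=
  ∀ e ∈ F, ∀ f ∈ F, e ≠ f → Disjoint (I.ends e) (I.ends f)

/-- A feasible matching: the set of covered vertices is independent in the matroid. -/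
def Feasible (I : MatchingInstance) (F : Finset (Fin I.numEdges)) : Prop :=
  I.IsMatching F ∧ I.M.Indep (I.covered F : Set (Fin I.numElts))

end MatchingInstance

/-! ### Random access programs with an independence oracle

The memory consists of arrays of natural numbers and arrays of real numbers, each addressed by a
fixed name in `ℕ` and an index computed at run time. The available arithmetic is addition,
(truncated) subtraction and comparison on natural numbers, and addition, subtraction and
comparison on real numbers. There is no multiplication, and no conversion between the two sorts.
-/

namespace OracleRAM

/-- Expressions for natural numbers; `get a i` reads the cell `i` of the array `a`. -/
inductive NExp where
  | lit (k : ℕ)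
  | get (a : ℕ) (i : NExp)
  | add (x y : NExp)
  | sub (x y : NExp)

/-- Expressions for real numbers. -/
inductive RExp where
  | lit (k : ℕ)
  | get (a : ℕ) (i : NExp)
  | add (x y : RExp)
  | sub (x y : RExp)

/-- Tests. -/
inductive Test where
  | le (x y : NExp)
  | rle (x y : RExp)
  | not (b : Test)
  | and (b c : Test)

/-- Programs. `setNat a i x` and `setReal a i x` store the value of `x` in the cell `i` of the
array `a`. `query a i q` asks the oracle about the set of all `j` with `q[j] ≠ 0` and stores the
answer (`1` for yes and `0` for no) in the cell `i` of the array `a`. -/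
inductive Program where
  | skip
  | setNat (a : ℕ) (i x : NExp)
  | setReal (a : ℕ) (i : NExp) (x : RExp)
  | query (a : ℕ) (i : NExp) (q : ℕ)
  | seq (P Q : Program)
  | branch (b : Test) (P Q : Program)
  | loop (b : Test) (P : Program)

/-- The content of the memory. -/
structure Memory where
  nat : ℕ → ℕ → ℕ
  real : ℕ → ℕ → ℝ

/-- Store a natural number in one cell. -/
def Memory.storeNat (s : Memory) (a i v : ℕ) : Memory :=
  { s with nat := Function.update s.nat a (Function.update (s.nat a) i v) }

/-- Store a real number in one cell. -/
noncomputable def Memory.storeReal (s : Memory) (a i : ℕ) (v : ℝ) : Memory :=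
  { s with real := Function.update s.real a (Function.update (s.real a) i v) }

/-- The value of an expression. -/
def NExp.eval (s : Memory) : NExp → ℕ
  | lit k => k
  | get a i => s.nat a (i.eval s)
  | add x y => x.eval s + y.eval s
  | sub x y => x.eval s - y.eval s

/-- The number of steps for evaluating an expression: one for each operation. -/
def NExp.cost : NExp → ℕ
  | lit _ => 1
  | get _ i => i.cost + 1
  | add x y => x.cost + y.cost + 1
  | sub x y => x.cost + y.cost + 1

/-- The value of an expression. -/
noncomputable def RExp.eval (s : Memory) : RExp → ℝ
  | lit k => k
  | get a i => s.real a (i.eval s)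
  | add x y => x.eval s + y.eval s
  | sub x y => x.eval s - y.eval s

/-- The number of steps for evaluating an expression. -/
def RExp.cost : RExp → ℕ
  | lit _ => 1
  | get _ i => i.cost + 1
  | add x y => x.cost + y.cost + 1
  | sub x y => x.cost + y.cost + 1

/-- The outcome of a test. -/
def Test.holds (s : Memory) : Test → Prop
  | le x y => x.eval s ≤ y.eval s
  | rle x y => x.eval s ≤ y.eval s
  | not b => ¬ b.holds s
  | and b c => b.holds s ∧ c.holds s

/-- The number of steps for carrying out a test. -/
def Test.cost : Test → ℕ
  | le x y => x.cost + y.cost + 1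
  | rle x y => x.cost + y.cost + 1
  | not b => b.cost + 1
  | and b c => b.cost + c.cost + 1

open Classical in
/-- `Exec O P s t s'`: with the oracle `O`, the program `P` started in the memory `s` halts after
exactly `t` steps in the memory `s'`. A call of the oracle takes one step. -/
inductive Exec (O : Set ℕ → Prop) : Program → Memory → ℕ → Memory → Prop
  | skip (s : Memory) : Exec O .skip s 1 s
  | setNat (a : ℕ) (i x : NExp) (s : Memory) :
      Exec O (.setNat a i x) s (i.cost + x.cost + 1) (s.storeNat a (i.eval s) (x.eval s))
  | setReal (a : ℕ) (i : NExp) (x : RExp) (s : Memory) :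
      Exec O (.setReal a i x) s (i.cost + x.cost + 1) (s.storeReal a (i.eval s) (x.eval s))
  | query (a : ℕ) (i : NExp) (q : ℕ) (s : Memory) :
      Exec O (.query a i q) s (i.cost + 1)
        (s.storeNat a (i.eval s) (if O {j | s.nat q j ≠ 0} then 1 else 0))
  | seq {P Q : Program} {s s' s'' : Memory} {t t' : ℕ} :
      Exec O P s t s' → Exec O Q s' t' s'' → Exec O (.seq P Q) s (t + t') s''
  | branch_true {b : Test} {P Q : Program} {s s' : Memory} {t : ℕ} :
      b.holds s → Exec O P s t s' → Exec O (.branch b P Q) s (b.cost + t) s'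
  | branch_false {b : Test} {P Q : Program} {s s' : Memory} {t : ℕ} :
      ¬ b.holds s → Exec O Q s t s' → Exec O (.branch b P Q) s (b.cost + t) s'
  | loop_false {b : Test} {P : Program} {s : Memory} :
      ¬ b.holds s → Exec O (.loop b P) s b.cost s
  | loop_true {b : Test} {P : Program} {s s' s'' : Memory} {t t' : ℕ} :
      b.holds s → Exec O P s t s' → Exec O (.loop b P) s' t' s'' →
      Exec O (.loop b P) s (b.cost + t + t') s''

/-- Programs are deterministic: the running time and the final memory are unique. -/
theorem Exec.unique {O : Set ℕ → Prop} {P : Program} {s s₁ s₂ : Memory} {t₁ t₂ : ℕ}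
    (h₁ : Exec O P s t₁ s₁) (h₂ : Exec O P s t₂ s₂) : t₁ = t₂ ∧ s₁ = s₂ := by
  induction h₁ generalizing t₂ s₂ with
  | skip => cases h₂; exact ⟨rfl, rfl⟩
  | setNat => cases h₂; exact ⟨rfl, rfl⟩
  | setReal => cases h₂; exact ⟨rfl, rfl⟩
  | query => cases h₂; exact ⟨rfl, rfl⟩
  | seq _ _ ih ih' =>
    cases h₂ with
    | seq k k' =>
      obtain ⟨rfl, rfl⟩ := ih k
      obtain ⟨rfl, rfl⟩ := ih' k'
      exact ⟨rfl, rfl⟩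
  | branch_true hb _ ih =>
    cases h₂ with
    | branch_true _ k => obtain ⟨rfl, rfl⟩ := ih k; exact ⟨rfl, rfl⟩
    | branch_false hb' _ => exact absurd hb hb'
  | branch_false hb _ ih =>
    cases h₂ with
    | branch_true hb' _ => exact absurd hb' hb
    | branch_false _ k => obtain ⟨rfl, rfl⟩ := ih k; exact ⟨rfl, rfl⟩
  | loop_false hb =>
    cases h₂ with
    | loop_false _ => exact ⟨rfl, rfl⟩
    | loop_true hb' _ _ => exact absurd hb' hb
  | loop_true hb _ _ ih ih' =>
    cases h₂ with
    | loop_false hb' => exact absurd hb hb'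
    | loop_true _ k k' =>
      obtain ⟨rfl, rfl⟩ := ih k
      obtain ⟨rfl, rfl⟩ := ih' k'
      exact ⟨rfl, rfl⟩

end OracleRAM

namespace MatchingInstance

open OracleRAM

/-- The independence oracle of the matroid: is the given set of elements independent? -/
def oracle (I : MatchingInstance) (X : Set ℕ) : Prop :=
  I.M.Indep {i : Fin I.numElts | (i : ℕ) ∈ X}

/-- The memory at the start. Array `0` of natural numbers holds the number of elements and the
number of edges, the arrays `1` and `2` hold the endpoints of the edges, and array `0` of real
numbers holds the weights; all other cells are zero. The matroid is not part of the memory. -/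
noncomputable def input (I : MatchingInstance) (w : Fin I.numEdges → ℝ) : Memory where
  nat a i :=
    if a = 0 then (if i = 0 then I.numElts else if i = 1 then I.numEdges else 0)
    else if h : i < I.numEdges then
      (if a = 1 then (I.fst ⟨i, h⟩ : ℕ) else if a = 2 then (I.snd ⟨i, h⟩ : ℕ) else 0)
    else 0
  real a i := if h : i < I.numEdges then (if a = 0 then w ⟨i, h⟩ else 0) else 0

/-- The start memory when no weights are given. -/
noncomputable def inputUnweighted (I : MatchingInstance) : Memory := I.input fun _ => 0

/-- The set of edges marked by nonzero entries in array `3` of natural numbers. -/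
def output (I : MatchingInstance) (s : Memory) : Finset (Fin I.numEdges) :=
  Finset.univ.filter fun e => s.nat 3 (e : ℕ) ≠ 0

/-- The size of an instance: the number of elements plus the number of edges. -/
def size (I : MatchingInstance) : ℕ := I.numElts + I.numEdges

end MatchingInstance

open OracleRAM in
/-- On every instance with a strongly base orderable matroid and nonnegative weights, the program
`P` halts in time bounded by a fixed polynomial in the size and outputs a feasible matching `F`
such that every feasible matching has weight at most `1 + ε` times that of `F`. -/
def WeightedApproxInPolyTime (ε : ℝ) (P : Program) : Prop :=
  ∃ p : Polynomial ℕ, ∀ I : MatchingInstance, I.M.StronglyBaseOrderable →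
    ∀ w : Fin I.numEdges → ℝ, (∀ e, 0 ≤ w e) →
      ∃ (t : ℕ) (s : Memory), Exec I.oracle P (I.input w) t s ∧ t ≤ p.eval I.size ∧
        I.Feasible (I.output s) ∧
        ∀ B : Finset (Fin I.numEdges), I.Feasible B →
          ∑ e ∈ B, w e ≤ (1 + ε) * ∑ e ∈ I.output s, w e

open OracleRAM in
/-- The same for instances without weights, where the number of edges is maximized. -/
def UnweightedApproxInPolyTime (ε : ℝ) (P : Program) : Prop :=
  ∃ p : Polynomial ℕ, ∀ I : MatchingInstance, I.M.StronglyBaseOrderable →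
    ∃ (t : ℕ) (s : Memory), Exec I.oracle P I.inputUnweighted t s ∧ t ≤ p.eval I.size ∧
      I.Feasible (I.output s) ∧
      ∀ B : Finset (Fin I.numEdges), I.Feasible B →
        (B.card : ℝ) ≤ (1 + ε) * ((I.output s).card : ℝ)

/-! The program is a local search. With `L = 3 * (2 * R + 1)` and `R` depending only on `ε`, each
round replaces the current feasible matching `A` by one at least as heavy as every feasible matching
that differs from `A` in at most `L` edges.

Bounded swaps suffice for the following reason. Extend the vertex sets of `A` and of a rival `B` to
bases, take an exchange bijection `π`, and let `a ∈ A` conflict with `b ∈ B` if `π` sends an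
endpoint of `a` to an endpoint of `b`. Every edge has at most two conflicts, and inserting any `X ⊆
B` while deleting its conflicts from `A` gives a feasible matching (`exists_conflicts`). Join two
edges of `B` if they share a conflict: this graph has maximum degree two, so its balls grow
linearly, and some ball of radius below `R` around a heaviest edge gains at most a factor `1 + δ` in
weight from its next layer (`exists_light_layer`). Removing the ball with that layer and repeating
yields pieces with disjoint conflict sets. If no swap gains more than `g`, summing over the pieces
gives `w(B) ≤ (1 + δ) (w(A) + m g)`, where `m` is the number of edges (`sum_le_of_bounded_swaps`,
`weight_le_of_local_gain`).

No local optimum has to be reached, which matters for real weights. Taking for `g` the gain of one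
round, the inequality says that the round shrinks the deficit `w(B) - (1 + δ) w(A)` by a factor `1 -
1/m`. After `k m` rounds, with `k` constant, a second factor `1 + δ` absorbs what is left
(`localSearch_spec`). The rest is verification of the program by a small calculus of time-bounded
Hoare triples. -/

/-! ### Covering a graph of maximum degree two by small pieces -/

section Growth

variable {β : Type*} [DecidableEq β]

open Classical in
/-- The elements of `B` within distance `r` of `b` for the relation `adj`. -/
noncomputable def growBall (B : Finset β) (adj : β → β → Prop) (b : β) : ℕ → Finset β
  | 0 => {b}
  | r + 1 => growBall B adj b r ∪ B.filter fun y => ∃ x ∈ growBall B adj b r, adj x y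

open Classical in
theorem growBall_subset_succ (B : Finset β) (adj : β → β → Prop) (b : β) (r : ℕ) :
    growBall B adj b r ⊆ growBall B adj b (r + 1) :=
  Finset.subset_union_left

open Classical in
theorem growBall_subset {B : Finset β} (adj : β → β → Prop) {b : β} (hb : b ∈ B) (r : ℕ) :
    growBall B adj b r ⊆ B := by
  induction r with
  | zero => simpa [growBall] using hb
  | succ r ih => exact Finset.union_subset ih (Finset.filter_subset _ _)

open Classical in
theorem mem_growBall_succ_of_adj {B : Finset β} {adj : β → β → Prop} {b x y : β} {r : ℕ}
    (hx : x ∈ growBall B adj b r) (hy : y ∈ B) (h : adj x y) :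
    y ∈ growBall B adj b (r + 1) := by
  rw [growBall, Finset.mem_union, Finset.mem_filter]
  exact Or.inr ⟨hy, x, hx, h⟩

theorem mem_growBall (B : Finset β) (adj : β → β → Prop) (b : β) (r : ℕ) :
    b ∈ growBall B adj b r := by
  induction r with
  | zero => simp [growBall]
  | succ r ih => exact growBall_subset_succ _ _ _ _ ih

-- A member of the last layer has a neighbour one layer further in, which uses up one of its two
-- neighbours. It therefore contributes at most one element to the next layer, and layers never grow
-- beyond the two neighbours of the centre.
open Classical in
theorem card_growBall_layer_le_two {B : Finset β} {adj : β → β → Prop} {b : β} (hb : b ∈ B)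
    (symm : ∀ x y, adj x y → adj y x)
    (deg : ∀ x ∈ B, (B.filter fun y => y ≠ x ∧ adj x y).card ≤ 2) (r : ℕ) :
    (growBall B adj b (r + 1) \ growBall B adj b r).card ≤ 2 := by
  induction r with
  | zero =>
    refine le_trans (Finset.card_le_card ?_) (deg b hb)
    intro y hy
    simp only [growBall, Finset.mem_sdiff, Finset.mem_union, Finset.mem_filter,
      Finset.mem_singleton] at hy ⊢
    obtain ⟨h | ⟨h, x, rfl, hx⟩, h'⟩ := hy
    · exact absurd h h'
    · exact ⟨h, h', hx⟩
  | succ r ih =>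
    refine le_trans ?_ ih
    set L := growBall B adj b (r + 1) \ growBall B adj b r with hL
    have hsub : growBall B adj b (r + 2) \ growBall B adj b (r + 1) ⊆
        L.biUnion fun x => B.filter fun y => adj x y ∧ y ∉ growBall B adj b (r + 1) := by
      intro y hy
      rw [Finset.mem_sdiff, growBall, Finset.mem_union, Finset.mem_filter] at hy
      obtain ⟨h | ⟨h, x, hx, hxy⟩, h'⟩ := hy
      · exact absurd h h'
      · refine Finset.mem_biUnion.2 ⟨x, ?_, Finset.mem_filter.2 ⟨h, hxy, h'⟩⟩
        refine Finset.mem_sdiff.2 ⟨hx, fun hx' => h' (mem_growBall_succ_of_adj hx' h hxy)⟩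
    refine (Finset.card_le_card hsub).trans ?_
    refine (Finset.card_biUnion_le_card_mul _ _ 1 ?_).trans (by simp)
    intro x hx
    obtain ⟨hx1, hx2⟩ := Finset.mem_sdiff.1 hx
    have hx3 := hx1
    rw [growBall, Finset.mem_union, Finset.mem_filter] at hx3
    obtain h | ⟨hxB, z, hz, hzx⟩ := hx3
    · exact absurd h hx2
    have hzB := growBall_subset adj hb r hz
    have hzx' : z ≠ x := fun h => hx2 (h ▸ hz)
    have hins : insert z (B.filter fun y => adj x y ∧ y ∉ growBall B adj b (r + 1)) ⊆
        B.filter fun y => y ≠ x ∧ adj x y := by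
      intro y hy
      rw [Finset.mem_insert, Finset.mem_filter] at hy
      rw [Finset.mem_filter]
      obtain rfl | ⟨h1, h2, h3⟩ := hy
      · exact ⟨hzB, hzx', symm _ _ hzx⟩
      · exact ⟨h1, fun h => h3 (h ▸ hx1), h2⟩
    have := (Finset.card_le_card hins).trans (deg x hxB)
    rw [Finset.card_insert_of_notMem] at this
    · omega
    · intro h
      exact (Finset.mem_filter.1 h).2.2 (growBall_subset_succ _ _ _ _ hz)

theorem card_growBall_le {B : Finset β} {adj : β → β → Prop} {b : β} (hb : b ∈ B)
    (symm : ∀ x y, adj x y → adj y x)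
    (deg : ∀ x ∈ B, (open Classical in B.filter fun y => y ≠ x ∧ adj x y).card ≤ 2) (r : ℕ) :
    (growBall B adj b r).card ≤ 2 * r + 1 := by
  induction r with
  | zero => simp [growBall]
  | succ r ih =>
    have h := card_growBall_layer_le_two hb symm deg r
    have := Finset.card_sdiff_add_card_eq_card (growBall_subset_succ B adj b r)
    omega

/-- Around an element of maximum weight some ball of bounded radius has a light boundary. -/
theorem exists_light_layer {B : Finset β} {adj : β → β → Prop} {b : β} (hb : b ∈ B)
    (symm : ∀ x y, adj x y → adj y x)
    (deg : ∀ x ∈ B, (open Classical in B.filter fun y => y ≠ x ∧ adj x y).card ≤ 2)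
    (w : β → ℝ) (hmax : ∀ x ∈ B, w x ≤ w b) {δ : ℝ} (hδ : 0 < δ) {R : ℕ} (hR : 0 < R)
    (hgrow : (2 * R + 1 : ℝ) ≤ (1 + δ) ^ R) (hw : 0 ≤ w b) :
    ∃ r < R, ∑ x ∈ growBall B adj b (r + 1), w x ≤ (1 + δ) * ∑ x ∈ growBall B adj b r, w x := by
  by_contra! hcon
  -- If every layer were heavy, the ball of radius `R` would weigh more than `(1 + δ) ^ R * w b`. It
  -- has at most `2 * R + 1` elements, none heavier than `b`.
  have hlow : ∀ r, r < R →
      (1 + δ) ^ (r + 1) * w b < ∑ x ∈ growBall B adj b (r + 1), w x := by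
    intro r
    induction r with
    | zero =>
      intro h
      simpa [growBall] using hcon 0 h
    | succ r ih =>
      intro h
      refine lt_trans ?_ (hcon (r + 1) h)
      have := mul_lt_mul_of_pos_left (ih (by omega)) (by linarith : 0 < 1 + δ)
      rwa [← mul_assoc, ← pow_succ'] at this
  have h1 := hlow (R - 1) (by omega)
  rw [Nat.sub_add_cancel hR] at h1
  have h2 : ∑ x ∈ growBall B adj b R, w x ≤ (growBall B adj b R).card • w b :=
    Finset.sum_le_card_nsmul _ _ _ fun x hx => hmax x (growBall_subset adj hb R hx)
  have h3 : ((growBall B adj b R).card : ℝ) ≤ 2 * R + 1 := by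
    exact_mod_cast card_growBall_le hb symm deg R
  rw [nsmul_eq_mul] at h2
  have h4 := mul_le_mul_of_nonneg_right (h3.trans hgrow) hw
  linarith

end Growth

/-- If every bounded piece of `B` outweighs its neighbourhood by at most `g`, then `B` outweighs
its neighbourhood by little. -/
theorem sum_le_of_bounded_swaps {α β : Type*} [DecidableEq α] [DecidableEq β]
    (nb : β → Finset α) (u : α → ℝ) (w : β → ℝ) (hu : ∀ a, 0 ≤ u a) (hw : ∀ b, 0 ≤ w b)
    {δ : ℝ} (hδ : 0 < δ) {R : ℕ} (hR : 0 < R) (hgrow : (2 * R + 1 : ℝ) ≤ (1 + δ) ^ R)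
    {g : ℝ} (hg : 0 ≤ g) (B : Finset β) (hnb : ∀ b ∈ B, (nb b).card ≤ 2)
    (hdeg : ∀ a, (B.filter fun b => a ∈ nb b).card ≤ 2)
    (hswap : ∀ X ⊆ B, X.card ≤ 2 * R + 1 → ∑ b ∈ X, w b ≤ ∑ a ∈ X.biUnion nb, u a + g) :
    ∑ b ∈ B, w b ≤ (1 + δ) * (∑ a ∈ B.biUnion nb, u a + B.card * g) := by
  classical
  induction B using Finset.strongInduction with
  | H B ih =>
  rcases B.eq_empty_or_nonempty with rfl | hne
  · simp
  obtain ⟨b, hb, hmax⟩ := B.exists_max_image w hne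
  -- Two elements are adjacent if they compete for a common neighbour in `α`.
  set adj : β → β → Prop := fun x y => ¬ Disjoint (nb x) (nb y) with hadj
  have symm : ∀ x y, adj x y → adj y x := fun x y h h' => h h'.symm
  have deg : ∀ x ∈ B, (B.filter fun y => y ≠ x ∧ adj x y).card ≤ 2 := by
    intro x hx
    have hsub : (B.filter fun y => y ≠ x ∧ adj x y) ⊆
        (nb x).biUnion fun a => (B.filter fun y => a ∈ nb y).erase x := by
      intro y hy
      obtain ⟨h1, h2, h3⟩ := Finset.mem_filter.1 hy
      obtain ⟨a, ha, ha'⟩ := Finset.not_disjoint_iff.1 h3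
      exact Finset.mem_biUnion.2 ⟨a, ha, Finset.mem_erase.2 ⟨h2, Finset.mem_filter.2 ⟨h1, ha'⟩⟩⟩
    refine (Finset.card_le_card hsub).trans ?_
    refine (Finset.card_biUnion_le_card_mul _ _ 1 ?_).trans (by simpa using hnb x hx)
    intro a ha
    -- Besides `x`, at most one element of `B` has `a` as a neighbour, so `x` gets at most one
    -- competitor from each of its at most two neighbours.
    rw [Finset.card_erase_of_mem (Finset.mem_filter.2 ⟨hx, ha⟩)]
    have := hdeg a
    omega
  have layer := exists_light_layer (adj := adj) hb symm (fun x hx => by convert deg x hx) w hmax hδ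
    hR hgrow (hw b)
  have cards := card_growBall_le (adj := adj) hb symm (fun x hx => by convert deg x hx)
  obtain ⟨r, hr, hlight⟩ := layer
  set X := growBall B adj b r with hX
  set Y := growBall B adj b (r + 1) with hY
  have hXB : X ⊆ B := growBall_subset adj hb r
  have hYB : Y ⊆ B := growBall_subset adj hb (r + 1)
  have hXcard : X.card ≤ 2 * R + 1 := (cards r).trans (by omega)
  -- The larger ball `Y` is discarded but only `X` is swapped in; the light layer lets the swap of
  -- `X` pay for all of `Y`.
  have hss : B \ Y ⊂ B :=
    Finset.sdiff_ssubset hYB ⟨b, mem_growBall _ _ _ _⟩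
  have hrec := ih (B \ Y) hss (fun b hb => hnb b (Finset.sdiff_subset hb))
    (fun a => (Finset.card_le_card (Finset.filter_subset_filter _ Finset.sdiff_subset)).trans
      (hdeg a)) (fun Z hZ => hswap Z (hZ.trans Finset.sdiff_subset))
  -- Anything in `B` adjacent to `X` lies in `Y`, so `X` and `B \ Y` compete for nothing and no part
  -- of `u` is charged twice.
  have hdis : Disjoint (X.biUnion nb) ((B \ Y).biUnion nb) := by
    rw [Finset.disjoint_biUnion_left]
    intro x hx
    rw [Finset.disjoint_biUnion_right]
    intro y hy
    by_contra h
    exact (Finset.mem_sdiff.1 hy).2 (mem_growBall_succ_of_adj hx (Finset.sdiff_subset hy) h)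
  have hsum : ∑ a ∈ X.biUnion nb, u a + ∑ a ∈ (B \ Y).biUnion nb, u a ≤
      ∑ a ∈ B.biUnion nb, u a := by
    rw [← Finset.sum_union hdis]
    refine Finset.sum_le_sum_of_subset_of_nonneg ?_ fun a _ _ => hu a
    exact Finset.union_subset (Finset.biUnion_subset_biUnion_of_subset_left _ hXB)
      (Finset.biUnion_subset_biUnion_of_subset_left _ Finset.sdiff_subset)
  have hcard : ((B \ Y).card : ℝ) + 1 ≤ B.card := by
    exact_mod_cast Finset.card_lt_card hss
  have hsplit := Finset.sum_sdiff (f := w) hYB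
  have h1 := hswap X hXB hXcard
  have h2 := mul_le_mul_of_nonneg_right hcard hg
  have h3 : 0 ≤ 1 + δ := by linarith
  have h4 := mul_le_mul_of_nonneg_left h1 h3
  calc ∑ b ∈ B, w b
      ≤ (1 + δ) * (∑ a ∈ (B \ Y).biUnion nb, u a + ((B \ Y).card : ℝ) * g) +
        (1 + δ) * (∑ a ∈ X.biUnion nb, u a + g) := by linarith
    _ = (1 + δ) * (∑ a ∈ X.biUnion nb, u a + ∑ a ∈ (B \ Y).biUnion nb, u a +
        (((B \ Y).card : ℝ) + 1) * g) := by ring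
    _ ≤ _ := mul_le_mul_of_nonneg_left (by linarith) h3

/-! ### Exchanges between feasible matchings -/

namespace Matroid

/-- The exchange bijection between two bases of a strongly base orderable matroid never maps an
element of `K` into `I \ K`. -/
theorem disjoint_image_of_exchange {α : Type*} [Finite α] {M : Matroid α} {I J : Set α}
    {π : α → α} (hI : M.IsBase I) (hπ : Set.BijOn π I J)
    (hex : ∀ K ⊆ I, M.IsBase (π '' K ∪ (I \ K))) {K : Set α} (hK : K ⊆ I) :
    Disjoint (π '' K) (I \ K) := by
  -- Both sides are bases of the same size and `π '' K` has as many elements as `K`, so the union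
  -- has no room for an overlap.
  have h1 := (hex K hK).ncard_eq_ncard_of_isBase hI
  have h2 := Set.ncard_union_add_ncard_inter (π '' K) (I \ K)
  have h3 : (π '' K).ncard = K.ncard := (hπ.injOn.mono hK).ncard_image
  have h4 := Set.ncard_sdiff_add_ncard_of_subset hK
  rw [Set.disjoint_iff_inter_eq_empty, ← Set.ncard_eq_zero]
  omega

end Matroid

namespace MatchingInstance

variable {I : MatchingInstance}

theorem mem_covered {F : Finset (Fin I.numEdges)} {v : Fin I.numElts} :
    v ∈ I.covered F ↔ ∃ e ∈ F, v ∈ I.ends e :=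
  Finset.mem_biUnion

theorem ends_card_le_two (e : Fin I.numEdges) : (I.ends e).card ≤ 2 :=
  Finset.card_le_two

theorem IsMatching.eq_of_mem {F : Finset (Fin I.numEdges)} (hF : I.IsMatching F)
    {e f : Fin I.numEdges} (he : e ∈ F) (hf : f ∈ F) {v : Fin I.numElts}
    (hve : v ∈ I.ends e) (hvf : v ∈ I.ends f) : e = f := by
  by_contra h
  exact Finset.disjoint_left.1 (hF e he f hf h) hve hvf

theorem feasible_empty (I : MatchingInstance) : I.Feasible ∅ := by
  simp [Feasible, IsMatching, covered]

/-- A feasible matching `B` can be inserted piecewise into a feasible matching `A` of a strongly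
base orderable matroid: to each edge of `B` belong at most two conflicting edges of `A`, and each
edge of `A` conflicts with at most two edges of `B`. -/
theorem exists_conflicts (hM : I.M.StronglyBaseOrderable) {A B : Finset (Fin I.numEdges)}
    (hA : I.Feasible A) (hB : I.Feasible B) :
    ∃ nb : Fin I.numEdges → Finset (Fin I.numEdges),
      (∀ b, nb b ⊆ A) ∧ (∀ b, (nb b).card ≤ 2) ∧
      (∀ a, (B.filter fun b => a ∈ nb b).card ≤ 2) ∧
      ∀ X ⊆ B, Disjoint (A \ X.biUnion nb) X ∧ I.Feasible ((A \ X.biUnion nb) ∪ X) := by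
  classical
  obtain ⟨S, hS, hAS⟩ := hA.2.exists_isBase_superset
  obtain ⟨T, hT, hBT⟩ := hB.2.exists_isBase_superset
  obtain ⟨π, hπ, hex⟩ := hM S T hS hT
  have hS' : ∀ a ∈ A, ∀ v ∈ I.ends a, v ∈ S := fun a ha v hv =>
    hAS (Finset.mem_coe.2 (mem_covered.2 ⟨a, ha, hv⟩))
  have hT' : ∀ b ∈ B, ∀ v ∈ I.ends b, v ∈ T := fun b hb v hv =>
    hBT (Finset.mem_coe.2 (mem_covered.2 ⟨b, hb, hv⟩))
  -- Conflict means that `π` maps an endpoint of `a` to an endpoint of `b`. Injectivity of `π` and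
  -- the two matching properties give both degree bounds.
  refine ⟨fun b => A.filter fun a => ∃ v ∈ I.ends a, π v ∈ I.ends b,
    fun b => Finset.filter_subset _ _, fun b => ?_, fun a => ?_, fun X hX => ?_⟩
  · have hsub : (A.filter fun a => ∃ v ∈ I.ends a, π v ∈ I.ends b) ⊆
        (I.ends b).biUnion fun u => A.filter fun a => ∃ v ∈ I.ends a, π v = u := by
      intro a ha
      obtain ⟨h1, v, hv, h2⟩ := Finset.mem_filter.1 ha
      exact Finset.mem_biUnion.2 ⟨π v, h2, Finset.mem_filter.2 ⟨h1, v, hv, rfl⟩⟩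
    refine (Finset.card_le_card hsub).trans ((Finset.card_biUnion_le_card_mul _ _ 1 ?_).trans
      (by simpa using ends_card_le_two b))
    intro u _
    rw [Finset.card_le_one]
    intro a ha a' ha'
    obtain ⟨h1, v, hv, h2⟩ := Finset.mem_filter.1 ha
    obtain ⟨h1', v', hv', h2'⟩ := Finset.mem_filter.1 ha'
    have : v = v' := hπ.injOn (hS' _ h1 _ hv) (hS' _ h1' _ hv') (h2.trans h2'.symm)
    subst this
    exact hA.1.eq_of_mem h1 h1' hv hv'
  · have hsub : (B.filter fun b => a ∈ A.filter fun a => ∃ v ∈ I.ends a, π v ∈ I.ends b) ⊆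
        (I.ends a).biUnion fun v => B.filter fun b => π v ∈ I.ends b := by
      intro b hb
      obtain ⟨h1, h2⟩ := Finset.mem_filter.1 hb
      obtain ⟨_, v, hv, h3⟩ := Finset.mem_filter.1 h2
      exact Finset.mem_biUnion.2 ⟨v, hv, Finset.mem_filter.2 ⟨h1, h3⟩⟩
    refine (Finset.card_le_card hsub).trans ((Finset.card_biUnion_le_card_mul _ _ 1 ?_).trans
      (by simpa using ends_card_le_two a))
    intro v _
    rw [Finset.card_le_one]
    intro b hb b' hb'
    obtain ⟨h1, h2⟩ := Finset.mem_filter.1 hb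
    obtain ⟨h1', h2'⟩ := Finset.mem_filter.1 hb'
    exact hB.1.eq_of_mem h1 h1' h2 h2'
  · set N := X.biUnion fun b => A.filter fun a => ∃ v ∈ I.ends a, π v ∈ I.ends b with hN
    -- Exchanging exactly the preimages of the vertices of `X` produces a base that contains all
    -- vertices of `X` and of `A \ N`.
    set K : Set (Fin I.numElts) := {v ∈ S | π v ∈ I.covered X} with hKdef
    have hK : K ⊆ S := Set.sep_subset _ _
    have hX' : ∀ b ∈ X, ∀ v ∈ I.ends b, v ∈ π '' K := by
      intro b hb v hv
      obtain ⟨y, hy, rfl⟩ := hπ.surjOn (hT' b (hX hb) v hv)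
      exact ⟨y, ⟨hy, mem_covered.2 ⟨b, hb, hv⟩⟩, rfl⟩
    have hA' : ∀ a ∈ A \ N, ∀ v ∈ I.ends a, v ∈ S \ K := by
      intro a ha v hv
      obtain ⟨ha, haN⟩ := Finset.mem_sdiff.1 ha
      refine ⟨hS' a ha v hv, fun hvK => haN ?_⟩
      obtain ⟨b, hb, hvb⟩ := mem_covered.1 hvK.2
      exact Finset.mem_biUnion.2 ⟨b, hb, Finset.mem_filter.2 ⟨ha, v, hv, hvb⟩⟩
    have hdis := Matroid.disjoint_image_of_exchange hS hπ hex hK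
    have hends : ∀ a ∈ A \ N, ∀ b ∈ X, Disjoint (I.ends a) (I.ends b) := by
      intro a ha b hb
      rw [Finset.disjoint_left]
      exact fun v hva hvb => Set.disjoint_left.1 hdis (hX' b hb v hvb) (hA' a ha v hva)
    refine ⟨?_, ?_, ?_⟩
    · rw [Finset.disjoint_left]
      intro a ha hb
      exact Finset.disjoint_left.1 (hends a ha a hb) (Finset.mem_insert_self _ _)
        (Finset.mem_insert_self _ _)
    · intro e he f hf hef
      rcases Finset.mem_union.1 he with he | he <;> rcases Finset.mem_union.1 hf with hf | hf
      · exact hA.1 e (Finset.sdiff_subset he) f (Finset.sdiff_subset hf) hef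
      · exact hends e he f hf
      · exact (hends f hf e he).symm
      · exact hB.1 e (hX he) f (hX hf) hef
    · refine (hex K hK).indep.subset ?_
      intro v hv
      obtain ⟨e, he, hve⟩ := mem_covered.1 (Finset.mem_coe.1 hv)
      rcases Finset.mem_union.1 he with he | he
      · exact Or.inr (hA' e he v hve)
      · exact Or.inl (hX' e he v hve)

/-- If no feasible matching close to the feasible matching `A` is heavier than `A` by more than
`g`, then no feasible matching is much heavier than `A`. -/
theorem weight_le_of_local_gain (hM : I.M.StronglyBaseOrderable) {w : Fin I.numEdges → ℝ}
    (hw : ∀ e, 0 ≤ w e) {δ : ℝ} (hδ : 0 < δ) {R : ℕ} (hR : 0 < R)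
    (hgrow : (2 * R + 1 : ℝ) ≤ (1 + δ) ^ R) {g : ℝ} (hg : 0 ≤ g)
    {A B : Finset (Fin I.numEdges)} (hA : I.Feasible A) (hB : I.Feasible B)
    (hloc : ∀ Z : Finset (Fin I.numEdges), Z.card ≤ 3 * (2 * R + 1) →
      I.Feasible (symmDiff A Z) → ∑ e ∈ symmDiff A Z, w e ≤ ∑ e ∈ A, w e + g) :
    ∑ e ∈ B, w e ≤ (1 + δ) * (∑ e ∈ A, w e + I.numEdges * g) := by
  obtain ⟨nb, hsub, hcard, hdeg, hswap⟩ := exists_conflicts hM hA hB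
  have key := sum_le_of_bounded_swaps nb w w hw hw hδ hR hgrow hg B (fun b _ => hcard b) hdeg ?_
  · refine key.trans (mul_le_mul_of_nonneg_left ?_ (by linarith))
    refine add_le_add ?_ (mul_le_mul_of_nonneg_right ?_ hg)
    · exact Finset.sum_le_sum_of_subset_of_nonneg (Finset.biUnion_subset.2 fun b _ => hsub b)
        fun e _ _ => hw e
    · exact_mod_cast (Finset.card_le_univ B).trans_eq (Fintype.card_fin _)
  · intro X hX hXc
    obtain ⟨hdis, hfeas⟩ := hswap X hX
    set N := X.biUnion nb with hN
    have hNA : N ⊆ A := Finset.biUnion_subset.2 fun b _ => hsub b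
    have hNc : N.card ≤ X.card * 2 := Finset.card_biUnion_le_card_mul _ _ _ fun b _ => hcard b
    -- The swap is encoded as a symmetric difference with `A`. It touches `X` and at most two edges
    -- of `A` per edge of `X`, hence the factor 3.
    have hsd : symmDiff A (symmDiff A ((A \ N) ∪ X)) = (A \ N) ∪ X :=
      symmDiff_symmDiff_cancel_left _ _
    have hZ : (symmDiff A ((A \ N) ∪ X)).card ≤ 3 * (2 * R + 1) := by
      have : symmDiff A ((A \ N) ∪ X) ⊆ N ∪ X := by
        intro e he
        simp only [Finset.mem_symmDiff, Finset.mem_union, Finset.mem_sdiff] at he ⊢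
        tauto
      have h1 := Finset.card_le_card this
      have h2 := Finset.card_union_le N X
      omega
    have h := hloc _ hZ (by rwa [hsd])
    rw [hsd, Finset.sum_union hdis] at h
    have := Finset.sum_sdiff (f := w) hNA
    linarith

end MatchingInstance

/-! ### Reasoning about random access programs -/

namespace OracleRAM

@[simp]
theorem Memory.storeNat_nat (s : Memory) (a i v b j : ℕ) :
    (s.storeNat a i v).nat b j = if b = a ∧ j = i then v else s.nat b j := by
  by_cases hb : b = a
  · subst hb
    by_cases hj : j = i
    · subst hj; simp [storeNat]
    · simp [storeNat, hj]
  · simp [storeNat, hb]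

@[simp]
theorem Memory.storeNat_real (s : Memory) (a i v : ℕ) : (s.storeNat a i v).real = s.real := rfl

@[simp]
theorem Memory.storeReal_nat (s : Memory) (a i : ℕ) (v : ℝ) :
    (s.storeReal a i v).nat = s.nat := rfl

@[simp]
theorem Memory.storeReal_real (s : Memory) (a i : ℕ) (v : ℝ) (b j : ℕ) :
    (s.storeReal a i v).real b j = if b = a ∧ j = i then v else s.real b j := by
  by_cases hb : b = a
  · subst hb
    by_cases hj : j = i
    · subst hj; simp [storeReal]
    · simp [storeReal, hj]
  · simp [storeReal, hb]

/-- The arrays of natural numbers that the program may change. -/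
def Program.writesNat : Program → ℕ → Prop
  | skip, _ => False
  | setNat a _ _, b => b = a
  | setReal _ _ _, _ => False
  | query a _ _, b => b = a
  | seq P Q, b => P.writesNat b ∨ Q.writesNat b
  | branch _ P Q, b => P.writesNat b ∨ Q.writesNat b
  | loop _ P, b => P.writesNat b

/-- The arrays of real numbers that the program may change. -/
def Program.writesReal : Program → ℕ → Prop
  | skip, _ => False
  | setNat _ _ _, _ => False
  | setReal a _ _, b => b = a
  | query _ _ _, _ => False
  | seq P Q, b => P.writesReal b ∨ Q.writesReal b
  | branch _ P Q, b => P.writesReal b ∨ Q.writesReal b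
  | loop _ P, b => P.writesReal b

/-- The memories `s` and `s'` differ only in arrays that `P` may change. -/
structure Agree (P : Program) (s s' : Memory) : Prop where
  nat : ∀ a, ¬ P.writesNat a → s'.nat a = s.nat a
  real : ∀ a, ¬ P.writesReal a → s'.real a = s.real a

/-- The frame rule. Since `Runs.mono` and `Runs.seq` hand this fact on, specifications mention only
what changes; the rest is read off the syntax of the program. -/
theorem Exec.agree {O : Set ℕ → Prop} {P : Program} {s s' : Memory} {t : ℕ}
    (h : Exec O P s t s') : Agree P s s' := by
  induction h with
  | skip => exact ⟨fun _ _ => rfl, fun _ _ => rfl⟩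
  | setNat a i x s =>
    exact ⟨fun b hb => Function.update_of_ne hb _ _, fun _ _ => rfl⟩
  | setReal a i x s =>
    exact ⟨fun _ _ => rfl, fun b hb => Function.update_of_ne hb _ _⟩
  | query a i q s =>
    exact ⟨fun b hb => Function.update_of_ne hb _ _, fun _ _ => rfl⟩
  | seq _ _ ih ih' =>
    exact ⟨fun a ha => (ih'.nat a fun h => ha (Or.inr h)).trans (ih.nat a fun h => ha (Or.inl h)),
      fun a ha => (ih'.real a fun h => ha (Or.inr h)).trans (ih.real a fun h => ha (Or.inl h))⟩
  | branch_true _ _ ih =>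
    exact ⟨fun a ha => ih.nat a fun h => ha (Or.inl h), fun a ha => ih.real a fun h => ha (Or.inl h)⟩
  | branch_false _ _ ih =>
    exact ⟨fun a ha => ih.nat a fun h => ha (Or.inr h), fun a ha => ih.real a fun h => ha (Or.inr h)⟩
  | loop_false _ => exact ⟨fun _ _ => rfl, fun _ _ => rfl⟩
  | loop_true _ _ _ ih ih' =>
    exact ⟨fun a ha => (ih'.nat a ha).trans (ih.nat a ha),
      fun a ha => (ih'.real a ha).trans (ih.real a ha)⟩

/-- Started in `s`, the program `P` halts within `T` steps in a memory that satisfies `Q`. -/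
def Runs (O : Set ℕ → Prop) (P : Program) (s : Memory) (T : ℕ) (Q : Memory → Prop) : Prop :=
  ∃ t s', Exec O P s t s' ∧ t ≤ T ∧ Q s'

namespace Runs

variable {O : Set ℕ → Prop} {P P' : Program} {s : Memory} {T T' : ℕ} {Q Q' : Memory → Prop}

theorem mono (h : Runs O P s T Q) (hT : T ≤ T') (hQ : ∀ s', Agree P s s' → Q s' → Q' s') :
    Runs O P s T' Q' := by
  obtain ⟨t, s', h, ht, hq⟩ := h
  exact ⟨t, s', h, ht.trans hT, hQ s' h.agree hq⟩

theorem skip (hQ : Q s) : Runs O .skip s 1 Q :=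
  ⟨_, _, .skip s, le_rfl, hQ⟩

theorem setNat {a : ℕ} {i x : NExp} (hQ : Q (s.storeNat a (i.eval s) (x.eval s))) :
    Runs O (.setNat a i x) s (i.cost + x.cost + 1) Q :=
  ⟨_, _, .setNat a i x s, le_rfl, hQ⟩

theorem setReal {a : ℕ} {i : NExp} {x : RExp} (hQ : Q (s.storeReal a (i.eval s) (x.eval s))) :
    Runs O (.setReal a i x) s (i.cost + x.cost + 1) Q :=
  ⟨_, _, .setReal a i x s, le_rfl, hQ⟩

open Classical in
theorem query {a : ℕ} {i : NExp} {q : ℕ}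
    (hQ : Q (s.storeNat a (i.eval s) (if O {j | s.nat q j ≠ 0} then 1 else 0))) :
    Runs O (.query a i q) s (i.cost + 1) Q :=
  ⟨_, _, .query a i q s, le_rfl, hQ⟩

theorem seq (h : Runs O P s T Q') (h' : ∀ s', Agree P s s' → Q' s' → Runs O P' s' T' Q) :
    Runs O (.seq P P') s (T + T') Q := by
  obtain ⟨t, s', h, ht, hq⟩ := h
  obtain ⟨t', s'', k, ht', hq'⟩ := h' s' h.agree hq
  exact ⟨_, _, .seq h k, add_le_add ht ht', hq'⟩

/-- The sum of the two bounds replaces their maximum, which keeps all time estimates linear. -/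
theorem branch {b : Test} (h : b.holds s → Runs O P s T Q) (h' : ¬ b.holds s → Runs O P' s T' Q) :
    Runs O (.branch b P P') s (b.cost + (T + T')) Q := by
  by_cases hb : b.holds s
  · obtain ⟨t, s', k, ht, hq⟩ := h hb
    exact ⟨_, _, .branch_true hb k, by omega, hq⟩
  · obtain ⟨t, s', k, ht, hq⟩ := h' hb
    exact ⟨_, _, .branch_false hb k, by omega, hq⟩

end Runs

/-- `for c[0] := 0, 1, …, bound - 1 do P`. -/
def Program.forLoop (c : ℕ) (bound : NExp) (P : Program) : Program :=
  .seq (.setNat c (.lit 0) (.lit 0))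
    (.loop (.not (.le bound (.get c (.lit 0))))
      (.seq P (.setNat c (.lit 0) (.add (.get c (.lit 0)) (.lit 1)))))

@[simp]
theorem Program.writesNat_forLoop {c : ℕ} {bound : NExp} {P : Program} {a : ℕ} :
    (Program.forLoop c bound P).writesNat a ↔ a = c ∨ P.writesNat a := by
  simp only [Program.forLoop, Program.writesNat]
  tauto

@[simp]
theorem Program.writesReal_forLoop {c : ℕ} {bound : NExp} {P : Program} {a : ℕ} :
    (Program.forLoop c bound P).writesReal a ↔ P.writesReal a := by
  simp only [Program.forLoop, Program.writesReal]
  tauto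

theorem Agree.trans {P : Program} {s s' s'' : Memory} (h : Agree P s s') (h' : Agree P s' s'') :
    Agree P s s'' :=
  ⟨fun a ha => (h'.nat a ha).trans (h.nat a ha), fun a ha => (h'.real a ha).trans (h.real a ha)⟩

theorem Agree.of_writes {P P' : Program} {s s' : Memory} (h : Agree P s s')
    (hn : ∀ a, P.writesNat a → P'.writesNat a) (hr : ∀ a, P.writesReal a → P'.writesReal a) :
    Agree P' s s' :=
  ⟨fun a ha => h.nat a fun h => ha (hn a h), fun a ha => h.real a fun h => ha (hr a h)⟩

theorem Agree.storeNat {P : Program} {s s' : Memory} (h : Agree P s s') {a : ℕ}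
    (ha : P.writesNat a) (i v : ℕ) : Agree P s (s'.storeNat a i v) := by
  refine ⟨fun b hb => ?_, h.real⟩
  rw [← h.nat b hb]
  exact Function.update_of_ne (fun e : b = a => hb (e ▸ ha)) _ _

/-- The invariant rule. The invariant is required after the counter has been stored, so it must
survive that store. One pass costs `bound.cost + 4` for the test and 6 for the increment on top of
the body. -/
theorem Runs.forLoop {O : Set ℕ → Prop} {c N T : ℕ} {bound : NExp} {P : Program} {s : Memory}
    (Inv : ℕ → Memory → Prop) (hc : ¬ P.writesNat c)
    (hbound : ∀ s', Agree (.forLoop c bound P) s s' → bound.eval s' = N)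
    (hzero : Inv 0 (s.storeNat c 0 0))
    (hstep : ∀ i < N, ∀ s', Agree (.forLoop c bound P) s s' → s'.nat c 0 = i → Inv i s' →
      Runs O P s' T fun s'' => Inv (i + 1) (s''.storeNat c 0 (i + 1))) :
    Runs O (.forLoop c bound P) s (N * (T + bound.cost + 10) + (bound.cost + 10)) (Inv N) := by
  have hcw : (Program.forLoop c bound P).writesNat c := by simp
  -- Induction on the number `k` of passes that remain, since the execution relation unfolds a loop
  -- from its front.
  have main : ∀ k i, i + k = N → ∀ s', Agree (.forLoop c bound P) s s' → s'.nat c 0 = i →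
      Inv i s' → Runs O (.loop (.not (.le bound (.get c (.lit 0))))
        (.seq P (.setNat c (.lit 0) (.add (.get c (.lit 0)) (.lit 1))))) s'
        (k * (T + bound.cost + 10) + (bound.cost + 4)) (Inv N) := by
    intro k
    induction k with
    | zero =>
      intro i hi s' hs' hsi hinv
      obtain rfl : i = N := by omega
      refine ⟨_, s', .loop_false ?_, ?_, hinv⟩
      · simp [Test.holds, NExp.eval, hbound s' hs', hsi]
      · simp [Test.cost, NExp.cost]
    | succ k ih =>
      intro i hi s' hs' hsi hinv
      obtain ⟨t, s'', hex, ht, hq⟩ := hstep i (by omega) s' hs' hsi hinv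
      have hci : s''.nat c 0 = i := by rw [hex.agree.nat c hc, hsi]
      have hset := Exec.setNat (O := O) c (.lit 0) (.add (.get c (.lit 0)) (.lit 1)) s''
      simp only [NExp.eval, hci] at hset
      have hag : Agree (.forLoop c bound P) s (s''.storeNat c 0 (i + 1)) :=
        (hs'.trans (hex.agree.of_writes (by simp +contextual) (by simp +contextual))).storeNat
          hcw _ _
      obtain ⟨t', s₃, hex', ht', hq'⟩ := ih (i + 1) (by omega) _ hag (by simp) hq
      refine ⟨_, s₃, .loop_true ?_ (.seq hex hset) hex', ?_, hq'⟩
      · simp only [Test.holds, NExp.eval, hbound s' hs', hsi]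
        omega
      · simp only [Test.cost, NExp.cost]
        rw [Nat.succ_mul]
        omega
  have hset := Exec.setNat (O := O) c (.lit 0) (.lit 0) s
  simp only [NExp.eval] at hset
  obtain ⟨t, s', hex, ht, hq⟩ := main N 0 (by omega) _
    (Agree.storeNat ⟨fun _ _ => rfl, fun _ _ => rfl⟩ hcw 0 0) (by simp) hzero
  refine ⟨_, s', .seq hset hex, ?_, hq⟩
  simp only [NExp.cost]
  omega

end OracleRAM

/-! ### The local search program

Array `3` holds the best matching found so far, array `4` the current candidate, array `5` the
vertices covered by the candidate, array `6` the outcome of the matching test, array `7` the answer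
of the oracle, and arrays `8`, `9` and `10 + j` loop counters. The arrays `1` and `2` of real
numbers hold the weights of the candidate and of the best matching. -/

namespace OracleRAM

/-- The number of elements. -/
def numEltsExp : NExp := .get 0 (.lit 0)

/-- The number of edges. -/
def numEdgesExp : NExp := .get 0 (.lit 1)

/-- The value of the loop counter in array `c`. -/
def counter (c : ℕ) : NExp := .get c (.lit 0)

/-- The `k`-fold multiple of an expression. -/
def NExp.mulLit (x : NExp) : ℕ → NExp
  | 0 => .lit 0
  | k + 1 => .add (x.mulLit k) x

theorem NExp.eval_mulLit (s : Memory) (x : NExp) (k : ℕ) :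
    (x.mulLit k).eval s = k * x.eval s := by
  induction k with
  | zero => simp [mulLit, eval]
  | succ k ih => rw [mulLit, eval, ih, Nat.succ_mul]

namespace Program

/-- Copy a set of edges. -/
def copyEdges (src dst : ℕ) : Program :=
  forLoop 8 numEdgesExp (.setNat dst (counter 8) (.get src (counter 8)))

/-- Unmark all vertices. -/
def clearCovered : Program := forLoop 8 numEltsExp (.setNat 5 (counter 8) (.lit 0))

/-- Mark the endpoints of the current edge, note a clash with earlier edges, and add the weight. -/
def scanEdge : Program :=
  .seq
    (.branch (.and (.le (.get 5 (.get 1 (counter 8))) (.lit 0))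
        (.le (.get 5 (.get 2 (counter 8))) (.lit 0)))
      .skip (.setNat 6 (.lit 0) (.lit 0)))
    (.seq (.setNat 5 (.get 1 (counter 8)) (.lit 1))
      (.seq (.setNat 5 (.get 2 (counter 8)) (.lit 1))
        (.setReal 1 (.lit 0) (.add (.get 1 (.lit 0)) (.get 0 (counter 8))))))

/-- Scan the edges of the candidate. -/
def scanEdges : Program :=
  forLoop 8 numEdgesExp (.branch (.le (.lit 1) (.get 4 (counter 8))) scanEdge .skip)

/-- Replace the best matching by the candidate if the latter is feasible and heavier. -/
def keepBetter : Program :=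
  .branch (.and (.le (.lit 1) (.get 6 (.lit 0))) (.and (.le (.lit 1) (.get 7 (.lit 0)))
      (.not (.rle (.get 1 (.lit 0)) (.get 2 (.lit 0))))))
    (.seq (copyEdges 4 3) (.setReal 2 (.lit 0) (.get 1 (.lit 0)))) .skip

/-- Compare the candidate with the best matching found so far. -/
def tryCandidate : Program :=
  .seq clearCovered (.seq (.setNat 6 (.lit 0) (.lit 1)) (.seq (.setReal 1 (.lit 0) (.lit 0))
    (.seq scanEdges (.seq (.query 7 (.lit 0) 5) keepBetter))))

/-- Add the current edge to the candidate or remove it. -/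
def toggle (c : ℕ) : Program :=
  .setNat 4 (counter c) (.sub (.lit 1) (.get 4 (counter c)))

/-- Try all sets that differ from the candidate in at most `j` edges. -/
def tryNear : ℕ → Program
  | 0 => tryCandidate
  | j + 1 => .seq (tryNear j)
      -- Each edge in turn serves as one of the differences. The second toggle restores the
      -- candidate, and each nesting depth has its own counter.
      (forLoop (10 + j) numEdgesExp
        (.seq (toggle (10 + j)) (.seq (tryNear j) (toggle (10 + j)))))

/-- One round of the local search. -/
def improve (L : ℕ) : Program := .seq (copyEdges 3 4) (tryNear L)

/-- Local search with `k` rounds per edge. -/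
def localSearch (L k : ℕ) : Program := forLoop 9 (numEdgesExp.mulLit k) (improve L)

/-- Let all edges have weight one. -/
def unitWeights : Program := forLoop 8 numEdgesExp (.setReal 0 (counter 8) (.lit 1))

/-- The three bounds protect the input arrays, the counters of the enclosing loops, and the round
counter 9. -/
theorem writesNat_tryNear {j a : ℕ} (h : (tryNear j).writesNat a) : 3 ≤ a ∧ a < 10 + j ∧ a ≠ 9 := by
  induction j with
  | zero =>
    simp [tryNear, tryCandidate, clearCovered, scanEdges, scanEdge, keepBetter, copyEdges,
      writesNat] at h
    omega
  | succ j ih =>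
    simp only [tryNear, writesNat, writesNat_forLoop, toggle] at h
    rcases h with h | h | h | h | h
    · have := ih h; omega
    · omega
    · omega
    · have := ih h; omega
    · omega

theorem writesReal_tryNear {j a : ℕ} (h : (tryNear j).writesReal a) : a ≠ 0 := by
  induction j with
  | zero =>
    simp [tryNear, tryCandidate, clearCovered, scanEdges, scanEdge, keepBetter, copyEdges,
      writesReal] at h
    omega
  | succ j ih =>
    simp only [tryNear, writesReal, writesReal_forLoop, toggle] at h
    tauto

end Program

end OracleRAM

/-! ### Memory invariants and copying of edge sets -/

namespace MatchingInstance

open OracleRAM Program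

variable {I : MatchingInstance} {w : Fin I.numEdges → ℝ} {s s' : Memory}

/-- The set of edges marked in an array. -/
def marked (I : MatchingInstance) (a : ℕ) (s : Memory) : Finset (Fin I.numEdges) :=
  Finset.univ.filter fun e => s.nat a (e : ℕ) ≠ 0

theorem mem_marked {a : ℕ} {e : Fin I.numEdges} : e ∈ I.marked a s ↔ s.nat a e ≠ 0 := by
  simp [marked]

theorem marked_congr {a b : ℕ} (h : ∀ e : Fin I.numEdges, s'.nat a e = s.nat b e) :
    I.marked a s' = I.marked b s := by
  ext e
  simp [mem_marked, h]

/-- The graph and the weights are stored in the memory. -/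
structure Loaded (I : MatchingInstance) (w : Fin I.numEdges → ℝ) (s : Memory) : Prop where
  numElts : s.nat 0 0 = I.numElts
  numEdges : s.nat 0 1 = I.numEdges
  fst : ∀ e : Fin I.numEdges, s.nat 1 e = I.fst e
  snd : ∀ e : Fin I.numEdges, s.nat 2 e = I.snd e
  weight : ∀ e : Fin I.numEdges, s.real 0 e = w e

theorem Loaded.congr (h : I.Loaded w s) (hn : ∀ a < 3, s'.nat a = s.nat a)
    (hr : s'.real 0 = s.real 0) : I.Loaded w s' where
  numElts := by rw [hn 0 (by omega), h.numElts]
  numEdges := by rw [hn 0 (by omega), h.numEdges]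
  fst e := by rw [hn 1 (by omega), h.fst]
  snd e := by rw [hn 2 (by omega), h.snd]
  weight e := by rw [hr, h.weight]

theorem Loaded.agree {P : Program} (h : I.Loaded w s) (ha : Agree P s s')
    (hn : ∀ a, P.writesNat a → 3 ≤ a) (hr : ¬ P.writesReal 0) : I.Loaded w s' :=
  h.congr (fun a h3 => ha.nat a fun h => by have := hn a h; omega) (ha.real 0 hr)

theorem loaded_input (I : MatchingInstance) (w : Fin I.numEdges → ℝ) : I.Loaded w (I.input w) := by
  constructor <;> simp [input]

/-- Array `3` holds a feasible matching, and its weight is known. -/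
structure BestStored (I : MatchingInstance) (w : Fin I.numEdges → ℝ) (s : Memory) : Prop where
  feasible : I.Feasible (I.marked 3 s)
  weight : s.real 2 0 = ∑ e ∈ I.marked 3 s, w e

theorem BestStored.congr (h : I.BestStored w s) (hn : s'.nat 3 = s.nat 3)
    (hr : s'.real 2 = s.real 2) : I.BestStored w s' := by
  have h3 : I.marked 3 s' = I.marked 3 s := marked_congr fun e => by rw [hn]
  exact ⟨h3 ▸ h.feasible, by rw [h3, hr, h.weight]⟩

theorem copyEdges_spec (O : Set ℕ → Prop) (hs : I.Loaded w s) {src dst : ℕ} (hsrc : src ≠ 8)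
    (hdst : 3 ≤ dst) (hdst' : dst ≠ 8) (hne : src ≠ dst) :
    Runs O (copyEdges src dst) s (30 * I.size + 30)
      fun s' => I.marked dst s' = I.marked src s := by
  have hn : ¬ (copyEdges src dst).writesNat src := by
    simp [copyEdges, Program.writesNat, hsrc, hne]
  refine Runs.mono (Q := fun s' => ∀ e : Fin I.numEdges, (e : ℕ) < I.numEdges →
    s'.nat dst e = s.nat src e) (Runs.forLoop (N := I.numEdges) (T := 8)
    (fun i s' => ∀ e : Fin I.numEdges, (e : ℕ) < i → s'.nat dst e = s.nat src e)
    ?_ ?_ ?_ ?_) ?_ ?_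
  · simpa [Program.writesNat] using hdst'.symm
  · intro s' ha
    exact (hs.agree ha (by simp [Program.writesNat]; omega) (by simp [Program.writesReal])).numEdges
  · simp
  · intro i hi s' ha hc hinv
    have hsr : s'.nat src = s.nat src := ha.nat src hn
    refine (Runs.setNat ?_).mono (by simp [NExp.cost, counter]) fun _ _ h => h
    intro e he
    simp only [counter, NExp.eval, hc, Memory.storeNat_nat, hdst', false_and, if_false, true_and,
      hsr]
    split_ifs with h
    · rw [h]
    · exact hinv e (by omega)
  · simp only [numEdgesExp, NExp.cost, size]
    omega
  · intro s' _ h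
    exact marked_congr fun e => h e e.2

theorem clearCovered_spec (O : Set ℕ → Prop) (hs : I.Loaded w s) :
    Runs O clearCovered s (30 * I.size + 30)
      fun s' => ∀ v : Fin I.numElts, s'.nat 5 v = 0 := by
  refine Runs.mono (Q := fun s' => ∀ v : Fin I.numElts, (v : ℕ) < I.numElts → s'.nat 5 v = 0)
    (Runs.forLoop (N := I.numElts) (T := 8)
    (fun i s' => ∀ v : Fin I.numElts, (v : ℕ) < i → s'.nat 5 v = 0) ?_ ?_ ?_ ?_) ?_ ?_
  · simp [Program.writesNat]
  · intro s' ha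
    exact (hs.agree ha (by simp [Program.writesNat]) (by simp [Program.writesReal])).numElts
  · simp
  · intro i hi s' ha hc hinv
    refine (Runs.setNat ?_).mono (by simp [NExp.cost, counter]) fun _ _ h => h
    intro v hv
    simp [counter, NExp.eval, hc]
    intro h
    exact hinv v (by omega)
  · simp only [numEltsExp, NExp.cost, size]
    omega
  · intro s' _ h v
    exact h v v.2

/-! ### Scanning and testing one candidate -/

theorem mem_covered_insert {F : Finset (Fin I.numEdges)} {e : Fin I.numEdges} {v : Fin I.numElts} :
    v ∈ I.covered (insert e F) ↔ v = I.fst e ∨ v = I.snd e ∨ v ∈ I.covered F := by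
  simp [covered, ends]

/-- This reduces the clash test to the marks of two vertices. Without `e ∉ F` the edge would clash
with itself. -/
theorem isMatching_insert {F : Finset (Fin I.numEdges)} {e : Fin I.numEdges} (he : e ∉ F) :
    I.IsMatching (insert e F) ↔
      I.IsMatching F ∧ I.fst e ∉ I.covered F ∧ I.snd e ∉ I.covered F := by
  constructor
  · intro h
    have key : ∀ v ∈ I.ends e, v ∉ I.covered F := by
      intro v hv hvF
      obtain ⟨f, hf, hvf⟩ := mem_covered.1 hvF
      have := h.eq_of_mem (Finset.mem_insert_self e F) (Finset.mem_insert_of_mem hf) hv hvf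
      exact he (this ▸ hf)
    exact ⟨fun a ha b hb => h a (Finset.mem_insert_of_mem ha) b (Finset.mem_insert_of_mem hb),
      key _ (by simp [ends]), key _ (by simp [ends])⟩
  · rintro ⟨h, h1, h2⟩
    have key : ∀ f ∈ F, Disjoint (I.ends e) (I.ends f) := by
      intro f hf
      rw [Finset.disjoint_left]
      intro v hv hvf
      have hc : v ∈ I.covered F := mem_covered.2 ⟨f, hf, hvf⟩
      rcases Finset.mem_insert.1 hv with rfl | hv
      · exact h1 hc
      · exact h2 (Finset.mem_singleton.1 hv ▸ hc)
    intro a ha b hb hab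
    rcases Finset.mem_insert.1 ha with rfl | ha' <;> rcases Finset.mem_insert.1 hb with rfl | hb'
    · exact absurd rfl hab
    · exact key b hb'
    · exact (key a ha').symm
    · exact h a ha' b hb' hab

/-- The bookkeeping of the scan describes the set `F` of edges. -/
structure Scanned (I : MatchingInstance) (w : Fin I.numEdges → ℝ) (F : Finset (Fin I.numEdges))
    (s : Memory) : Prop where
  covered : ∀ v : Fin I.numElts, s.nat 5 v ≠ 0 ↔ v ∈ I.covered F
  matching : s.nat 6 0 ≠ 0 ↔ I.IsMatching F
  weight : s.real 1 0 = ∑ e ∈ F, w e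

theorem Scanned.storeNat {F : Finset (Fin I.numEdges)} (h : I.Scanned w F s) (i v : ℕ) :
    I.Scanned w F (s.storeNat 8 i v) := by
  refine ⟨fun v => ?_, ?_, ?_⟩
  · simpa using h.covered v
  · simpa using h.matching
  · simpa using h.weight

theorem scanEdge_spec (O : Set ℕ → Prop) (hs : I.Loaded w s) {F : Finset (Fin I.numEdges)}
    {e : Fin I.numEdges} (he : e ∉ F) (hc : s.nat 8 0 = e) (h : I.Scanned w F s) :
    Runs O scanEdge s 60 (I.Scanned w (insert e F)) := by
  have hf0 : s.nat 5 (I.fst e) = 0 ↔ I.fst e ∉ I.covered F := by rw [← h.covered]; simp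
  have hs0 : s.nat 5 (I.snd e) = 0 ↔ I.snd e ∉ I.covered F := by rw [← h.covered]; simp
  -- The marks are tested before the endpoints of `e` are marked, so only earlier edges can cause a
  -- clash. A flag once cleared stays cleared.
  have hstep : Runs O (.branch (.and (.le (.get 5 (.get 1 (counter 8))) (.lit 0))
      (.le (.get 5 (.get 2 (counter 8))) (.lit 0))) .skip (.setNat 6 (.lit 0) (.lit 0))) s 25
      fun s' => (s'.nat 6 0 ≠ 0 ↔ I.IsMatching (insert e F)) := by
    refine (Runs.branch (fun hb => Runs.skip ?_) (fun hb => Runs.setNat ?_)).mono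
      (by simp [Test.cost, NExp.cost, counter]) fun _ _ h => h
    · simp only [Test.holds, NExp.eval, counter, hc, hs.fst, hs.snd, Nat.le_zero, hf0, hs0] at hb
      rw [isMatching_insert he, h.matching]
      exact ⟨fun h => ⟨h, hb⟩, fun h => h.1⟩
    · simp only [Test.holds, NExp.eval, counter, hc, hs.fst, hs.snd, Nat.le_zero, hf0, hs0] at hb
      rw [isMatching_insert he]
      simp only [NExp.eval, Memory.storeNat_nat]
      simp
      tauto
  refine Runs.mono (hstep.seq fun s₁ ha h₁ => Runs.seq (Runs.setNat rfl) fun s₂ _ h₂ =>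
    Runs.seq (Runs.setNat rfl) fun s₃ _ h₃ => Runs.setReal ?_)
    (by simp [RExp.cost, NExp.cost, counter]) fun _ _ h => h
  have h8 : s₁.nat 8 0 = e := by rw [ha.nat 8 (by simp [Program.writesNat]), hc]
  have hL : I.Loaded w s₁ :=
    hs.agree ha (by simp [Program.writesNat]) (by simp [Program.writesReal])
  have h5 : s₁.nat 5 = s.nat 5 := ha.nat 5 (by simp [Program.writesNat])
  have hr1 : s₁.real 1 = s.real 1 := ha.real 1 (by simp [Program.writesReal])
  simp only [NExp.eval, counter, h8, hL.fst] at h₂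
  subst h₂
  simp [NExp.eval, counter, h8, hL.snd] at h₃
  subst h₃
  refine ⟨fun v => ?_, ?_, ?_⟩
  · rw [mem_covered_insert, ← h.covered]
    simp [h5, Fin.val_inj]
    by_cases h1 : v = I.snd e <;> by_cases h2 : v = I.fst e <;> simp [h1, h2]
  · simpa using h₁
  · rw [Finset.sum_insert he, ← h.weight]
    simp [RExp.eval, NExp.eval, counter, h8, hL.weight, hr1, add_comm]

theorem scanEdges_spec (O : Set ℕ → Prop) (hs : I.Loaded w s)
    (h5 : ∀ v : Fin I.numElts, s.nat 5 v = 0)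
    (h6 : s.nat 6 0 = 1) (hw : s.real 1 0 = 0) :
    Runs O scanEdges s (90 * I.size + 30) (I.Scanned w (I.marked 4 s)) := by
  refine Runs.mono (Q := I.Scanned w ((I.marked 4 s).filter fun e => (e : ℕ) < I.numEdges))
    (Runs.forLoop (N := I.numEdges) (T := 70)
    (fun i s' => I.Scanned w ((I.marked 4 s).filter fun e => (e : ℕ) < i) s') ?_ ?_ ?_ ?_) ?_ ?_
  · simp [Program.writesNat, scanEdge]
  · intro s' ha
    exact (hs.agree ha (by simp [Program.writesNat, scanEdge])
      (by simp [Program.writesReal, scanEdge])).numEdges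
  · refine ⟨fun v => ?_, ?_, ?_⟩
    · simp [h5, MatchingInstance.covered]
    · simp [h6, IsMatching]
    · simp [hw]
  · intro i hi s' ha hc hinv
    have hs' := hs.agree ha (by simp [Program.writesNat, scanEdge])
      (by simp [Program.writesReal, scanEdge])
    have h4 : s'.nat 4 = s.nat 4 := ha.nat 4 (by simp [Program.writesNat, scanEdge])
    set e : Fin I.numEdges := ⟨i, hi⟩ with he
    refine (Runs.branch (T := 60) (T' := 1) (fun hb => ?_) fun hb => Runs.skip ?_).mono
      (by simp [Test.cost, NExp.cost, counter]) fun _ _ h => h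
    · simp only [Test.holds, NExp.eval, counter, hc, h4] at hb
      have hins : ((I.marked 4 s).filter fun f : Fin I.numEdges => (f : ℕ) < i + 1) =
          insert e ((I.marked 4 s).filter fun f : Fin I.numEdges => (f : ℕ) < i) := by
        ext f
        simp only [Finset.mem_filter, Finset.mem_insert, mem_marked, Fin.ext_iff, he]
        constructor
        · rintro ⟨h1, h2⟩
          by_cases h : (f : ℕ) = i
          · exact Or.inl h
          · exact Or.inr ⟨h1, by omega⟩
        · rintro (h | h)
          · rw [h]; omega
          · exact ⟨h.1, by omega⟩
      rw [hins]
      exact (scanEdge_spec O hs' (by simp [he]) hc hinv).mono le_rfl fun _ _ h => h.storeNat _ _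
    · simp only [Test.holds, NExp.eval, counter, hc, h4] at hb
      have hsame : ((I.marked 4 s).filter fun f : Fin I.numEdges => (f : ℕ) < i + 1) =
          (I.marked 4 s).filter fun f : Fin I.numEdges => (f : ℕ) < i := by
        ext f
        simp only [Finset.mem_filter, mem_marked]
        refine and_congr_right fun h1 => ⟨fun h2 => ?_, fun h2 => by omega⟩
        by_contra h
        have : (f : ℕ) = i := by omega
        rw [this] at h1
        omega
      rw [hsame]
      exact hinv.storeNat _ _
  · simp only [numEdgesExp, NExp.cost, size]
    omega
  · intro s' _ h
    rwa [Finset.filter_true_of_mem fun e _ => e.2] at h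

theorem keepBetter_spec (O : Set ℕ → Prop) (hs : I.Loaded w s) (hbest : I.BestStored w s)
    (hmat : s.nat 6 0 ≠ 0 ↔ I.IsMatching (I.marked 4 s))
    (hind : s.nat 7 0 ≠ 0 ↔ I.M.Indep (I.covered (I.marked 4 s) : Set (Fin I.numElts)))
    (hw : s.real 1 0 = ∑ e ∈ I.marked 4 s, w e) :
    Runs O keepBetter s (30 * I.size + 60) fun s' =>
      I.BestStored w s' ∧ ∑ e ∈ I.marked 3 s, w e ≤ ∑ e ∈ I.marked 3 s', w e ∧
      (I.Feasible (I.marked 4 s) → ∑ e ∈ I.marked 4 s, w e ≤ ∑ e ∈ I.marked 3 s', w e) := by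
  refine (Runs.branch (T := 30 * I.size + 30 + 4) (T' := 1) (fun hb => ?_)
    fun hb => Runs.skip ?_).mono (by simp only [Test.cost, NExp.cost, RExp.cost]; omega)
    fun _ _ h => h
  · simp only [Test.holds, NExp.eval, RExp.eval, Nat.one_le_iff_ne_zero, hmat, hind, hw,
      hbest.weight, not_le] at hb
    refine (copyEdges_spec O hs (by decide) (by decide) (by decide) (by decide)).seq
      fun s₁ ha h₁ => (Runs.setReal ?_)
    have h3 : I.marked 3 (s₁.storeReal 2 0 (s₁.real 1 0)) = I.marked 4 s := h₁
    simp only [NExp.eval, RExp.eval, h3]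
    refine ⟨⟨h3 ▸ ⟨hb.1, hb.2.1⟩, ?_⟩, hb.2.2.le, fun _ => le_rfl⟩
    rw [h3, ← hw, ← ha.real 1 (by simp [copyEdges, Program.writesReal])]
    simp
  · simp only [Test.holds, NExp.eval, RExp.eval, Nat.one_le_iff_ne_zero, hmat, hind, hw,
      hbest.weight, not_le] at hb
    refine ⟨hbest, le_rfl, fun hf => ?_⟩
    by_contra hlt
    exact hb ⟨hf.1, hf.2, not_le.1 hlt⟩

theorem tryCandidate_spec (hs : I.Loaded w s) (hbest : I.BestStored w s) :
    Runs I.oracle tryCandidate s (200 * I.size + 200) fun s' =>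
      I.BestStored w s' ∧ ∑ e ∈ I.marked 3 s, w e ≤ ∑ e ∈ I.marked 3 s', w e ∧
      (I.Feasible (I.marked 4 s) → ∑ e ∈ I.marked 4 s, w e ≤ ∑ e ∈ I.marked 3 s', w e) := by
  classical
  refine Runs.mono ((clearCovered_spec I.oracle hs).seq fun s₁ ha₁ h₁ =>
    Runs.seq (Runs.setNat rfl) fun s₂ ha₂ h₂ =>
    Runs.seq (Runs.setReal rfl) fun s₃ ha₃ h₃ =>
    Runs.seq (T := 90 * I.size + 30) (T' := 2 + (30 * I.size + 60))
      (Q' := I.Scanned w (I.marked 4 s)) ?_ fun s₄ ha₄ h₄ =>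
    Runs.seq (Runs.query rfl) fun s₅ ha₅ h₅ => ?_)
    (by simp only [NExp.cost, RExp.cost]; omega) fun _ _ h => h
  · have hs₃ : I.Loaded w s₃ := ((hs.agree ha₁ (by simp [Program.writesNat, clearCovered])
      (by simp [Program.writesReal, clearCovered])).agree ha₂ (by simp [Program.writesNat])
      (by simp [Program.writesReal])).agree ha₃ (by simp [Program.writesNat])
      (by simp [Program.writesReal])
    have h4 : I.marked 4 s₃ = I.marked 4 s := marked_congr fun e => by
      rw [ha₃.nat 4 (by simp [Program.writesNat]), ha₂.nat 4 (by simp [Program.writesNat]),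
        ha₁.nat 4 (by simp [Program.writesNat, clearCovered])]
    rw [← h4]
    subst h₃ h₂
    refine scanEdges_spec I.oracle hs₃ (fun v => ?_) ?_ ?_
    · simpa using h₁ v
    · simp [NExp.eval]
    · simp [NExp.eval, RExp.eval]
  · have hn : ∀ a, a ≠ 5 → a ≠ 6 → a ≠ 7 → a ≠ 8 → s₅.nat a = s.nat a := by
      intro a h5 h6 h7 h8
      rw [ha₅.nat a (by simp [Program.writesNat, *]),
        ha₄.nat a (by simp [Program.writesNat, scanEdges, scanEdge, *]),
        ha₃.nat a (by simp [Program.writesNat]), ha₂.nat a (by simp [Program.writesNat, *]),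
        ha₁.nat a (by simp [Program.writesNat, clearCovered, *])]
    have hr : ∀ a, a ≠ 1 → s₅.real a = s.real a := by
      intro a h1
      rw [ha₅.real a (by simp [Program.writesReal]),
        ha₄.real a (by simp [Program.writesReal, scanEdges, scanEdge, *]),
        ha₃.real a (by simp [Program.writesReal, *]), ha₂.real a (by simp [Program.writesReal]),
        ha₁.real a (by simp [Program.writesReal, clearCovered])]
    have h4 : I.marked 4 s₅ = I.marked 4 s := marked_congr fun e => by rw [hn 4] <;> decide
    have h3 : I.marked 3 s₅ = I.marked 3 s := marked_congr fun e => by rw [hn 3] <;> decide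
    have hs₅ : I.Loaded w s₅ :=
      hs.congr (fun a ha => hn a (by omega) (by omega) (by omega) (by omega)) (hr 0 (by decide))
    have hb₅ : I.BestStored w s₅ :=
      hbest.congr (hn 3 (by decide) (by decide) (by decide) (by decide)) (hr 2 (by decide))
    -- The set presented to the oracle is exactly the set of vertices covered by the candidate.
    have hcov : {v : Fin I.numElts | (v : ℕ) ∈ {j | s₄.nat 5 j ≠ 0}} =
        (I.covered (I.marked 4 s) : Set (Fin I.numElts)) := by
      ext v
      exact h₄.covered v
    rw [← h4, ← h3]
    rw [← h4] at h₄ hcov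
    refine keepBetter_spec I.oracle hs₅ hb₅ ?_ ?_ ?_
    · rw [← h₄.matching, ha₅.nat 6 (by simp [Program.writesNat])]
    · have h7 : s₅.nat 7 0 = if I.oracle {j | s₄.nat 5 j ≠ 0} then 1 else 0 := by
        rw [← h₅]
        simp only [NExp.eval, Memory.storeNat_nat, and_self, if_true]
      rw [h7, oracle, hcov]
      split_ifs with h <;> simp [h]
    · rw [ha₅.real 1 (by simp [Program.writesReal]), h₄.weight]

/-! ### Enumerating the sets near the candidate -/

theorem toggle_spec (O : Set ℕ → Prop) {c : ℕ} {e : Fin I.numEdges} (hc : s.nat c 0 = e) :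
    Runs O (toggle c) s 8 fun s' => I.marked 4 s' = symmDiff (I.marked 4 s) {e} := by
  refine (Runs.setNat ?_).mono (by simp [NExp.cost, counter]) fun _ _ h => h
  ext f
  simp only [mem_marked, Finset.mem_symmDiff, Finset.mem_singleton, counter, NExp.eval, hc,
    Memory.storeNat_nat, true_and, Fin.val_inj]
  by_cases hf : f = e
  · subst hf
    simp
    omega
  · simp [hf]

/-- A time bound for `tryNear j` on instances of size `n`. -/
def tryNearTime (n : ℕ) : ℕ → ℕ
  | 0 => 200 * n + 200
  | j + 1 => tryNearTime n j + (n * (tryNearTime n j + 50) + 50)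

/-- A set `Z` of size `j + 1` is reached by toggling some `f ∈ Z` and then treating `Z.erase f`
recursively. Array 4 is restored, so every pass starts from the same candidate, and the best weight
never drops, so a bound once achieved persists. -/
theorem tryNear_spec (j : ℕ) (hs : I.Loaded w s) (hbest : I.BestStored w s) :
    Runs I.oracle (tryNear j) s (tryNearTime I.size j) fun s' =>
      I.marked 4 s' = I.marked 4 s ∧ I.BestStored w s' ∧
      ∑ e ∈ I.marked 3 s, w e ≤ ∑ e ∈ I.marked 3 s', w e ∧
      ∀ Z : Finset (Fin I.numEdges), Z.card ≤ j → I.Feasible (symmDiff (I.marked 4 s) Z) →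
        ∑ e ∈ symmDiff (I.marked 4 s) Z, w e ≤ ∑ e ∈ I.marked 3 s', w e := by
  induction j generalizing s with
  | zero =>
    refine (tryCandidate_spec hs hbest).mono le_rfl fun s' ha h => ⟨?_, h.1, h.2.1, ?_⟩
    · refine marked_congr fun e => ?_
      rw [ha.nat 4 (by simp [tryCandidate, clearCovered, scanEdges, scanEdge, keepBetter,
        copyEdges, Program.writesNat])]
    · intro Z hZ hf
      obtain rfl : Z = ∅ := Finset.card_eq_zero.1 (by omega)
      have he : symmDiff (I.marked 4 s) ∅ = I.marked 4 s := symmDiff_bot _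
      rw [he] at hf ⊢
      exact h.2.2 hf
  | succ j ih =>
    set G := I.marked 4 s with hG
    have hwn : ∀ a, (Program.forLoop (10 + j) numEdgesExp
        (.seq (toggle (10 + j)) (.seq (tryNear j) (toggle (10 + j))))).writesNat a → 3 ≤ a := by
      intro a h
      simp only [writesNat_forLoop, Program.writesNat, toggle] at h
      rcases h with h | h | h | h
      · omega
      · omega
      · exact (writesNat_tryNear h).1
      · omega
    have hwr : ¬ (Program.forLoop (10 + j) numEdgesExp
        (.seq (toggle (10 + j)) (.seq (tryNear j) (toggle (10 + j))))).writesReal 0 := by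
      simp only [writesReal_forLoop, Program.writesReal, toggle]
      rintro (h | h | h)
      · exact h
      · exact writesReal_tryNear h rfl
      · exact h
    have hne : 10 + j ≠ 4 := by omega
    have hne3 : 3 ≠ 10 + j := by omega
    have hne4 : 4 ≠ 10 + j := by omega
    have hwc : ¬ (tryNear j).writesNat (10 + j) := fun h => by
      have := writesNat_tryNear h; omega
    refine (ih hs hbest).seq fun s₁ ha₁ h₁ => ?_
    obtain ⟨hG₁, hb₁, hle₁, hZ₁⟩ := h₁
    have hs₁ : I.Loaded w s₁ := hs.agree ha₁ (fun a h => (writesNat_tryNear h).1)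
      fun h => writesReal_tryNear h rfl
    refine Runs.mono (Runs.forLoop (N := I.numEdges) (T := tryNearTime I.size j + 20)
      (fun i s' => I.marked 4 s' = G ∧ I.BestStored w s' ∧
        ∑ e ∈ I.marked 3 s₁, w e ≤ ∑ e ∈ I.marked 3 s', w e ∧
        ∀ f : Fin I.numEdges, (f : ℕ) < i → ∀ Z : Finset (Fin I.numEdges), Z.card ≤ j →
          I.Feasible (symmDiff (symmDiff G {f}) Z) →
          ∑ e ∈ symmDiff (symmDiff G {f}) Z, w e ≤ ∑ e ∈ I.marked 3 s', w e) ?_ ?_ ?_ ?_) ?_ ?_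
    · simp [toggle, Program.writesNat, hne, hwc]
    · intro s' ha
      exact (hs₁.agree ha hwn hwr).numEdges
    · have h3 : I.marked 3 (s₁.storeNat (10 + j) 0 0) = I.marked 3 s₁ :=
        marked_congr fun e => by simp [hne3]
      refine ⟨?_, hb₁.congr (by funext k; simp [hne3]) rfl, by rw [h3], by simp⟩
      rw [hG, ← hG₁]
      exact marked_congr fun e => by simp [hne4]
    · intro i hi s' ha hc hinv
      obtain ⟨hG', hb', hle', hZ'⟩ := hinv
      have hs' : I.Loaded w s' := hs₁.agree ha hwn hwr
      refine Runs.mono (T := 8 + (tryNearTime I.size j + 8)) (Q := fun s₅ => I.marked 4 s₅ = G ∧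
        I.BestStored w s₅ ∧ ∑ e ∈ I.marked 3 s', w e ≤ ∑ e ∈ I.marked 3 s₅, w e ∧
        ∀ Z : Finset (Fin I.numEdges), Z.card ≤ j →
          I.Feasible (symmDiff (symmDiff G {⟨i, hi⟩}) Z) →
          ∑ e ∈ symmDiff (symmDiff G {⟨i, hi⟩}) Z, w e ≤ ∑ e ∈ I.marked 3 s₅, w e)
        ((toggle_spec I.oracle (e := ⟨i, hi⟩) hc).seq fun s₂ ha₂ h4 => ?_) (by omega) ?_
      · have hs₂ : I.Loaded w s₂ :=
          hs'.agree ha₂ (by simp [toggle, Program.writesNat]) (by simp [toggle, Program.writesReal])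
        have hb₂ : I.BestStored w s₂ := hb'.congr (ha₂.nat 3 (by simp [toggle, Program.writesNat]))
          (ha₂.real 2 (by simp [toggle, Program.writesReal]))
        have h3 : I.marked 3 s₂ = I.marked 3 s' := marked_congr fun e => by
          rw [ha₂.nat 3 (by simp [toggle, Program.writesNat])]
        rw [hG'] at h4
        refine (ih hs₂ hb₂).seq fun s₃ ha₃ h₃ => ?_
        obtain ⟨hG₃, hb₃, hle₃, hZ₃⟩ := h₃
        have hc₃ : s₃.nat (10 + j) 0 = i := by
          rw [ha₃.nat _ hwc, ha₂.nat _ (by simpa [toggle, Program.writesNat] using hne), hc]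
        refine (toggle_spec I.oracle (e := ⟨i, hi⟩) hc₃).mono le_rfl fun s₄ ha₄ h4' => ?_
        rw [hG₃, h4, symmDiff_symmDiff_cancel_right] at h4'
        rw [h4] at hZ₃
        have hn3 : s₄.nat 3 = s₃.nat 3 := ha₄.nat 3 (by simp [toggle, Program.writesNat])
        have h3' : I.marked 3 s₄ = I.marked 3 s₃ := marked_congr fun e => by rw [hn3]
        refine ⟨h4', hb₃.congr hn3 (ha₄.real 2 (by simp [toggle, Program.writesReal])), ?_, ?_⟩
        · rw [h3', ← h3]; exact hle₃
        · rw [h3']; exact hZ₃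
      · rintro s₅ - ⟨hG₅, hb₅, hle₅, hZ₅⟩
        have h3 : ∀ k v, I.marked 3 (s₅.storeNat (10 + j) k v) = I.marked 3 s₅ := fun k v =>
          marked_congr fun e => by simp [hne3]
        refine ⟨?_, hb₅.congr (by funext k; simp [hne3]) rfl, ?_, ?_⟩
        · rw [← hG₅]
          exact marked_congr fun e => by simp [hne4]
        · rw [h3]
          exact hle'.trans hle₅
        · rw [h3]
          intro f hf Z hZ hfe
          by_cases h : (f : ℕ) = i
          · obtain rfl : f = ⟨i, hi⟩ := Fin.ext h
            exact hZ₅ Z hZ hfe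
          · exact (hZ' f (by omega) Z hZ hfe).trans hle₅
    · have : I.numEdges * (tryNearTime I.size j + 20 + (1 + 1) + 10) ≤
          I.size * (tryNearTime I.size j + 50) :=
        Nat.mul_le_mul (by simp [size]) (by omega)
      simp only [numEdgesExp, NExp.cost]
      omega
    · rintro s₂ - ⟨hG₂, hb₂, hle₂, hZ₂⟩
      refine ⟨hG₂, hb₂, hle₁.trans hle₂, fun Z hZ hfe => ?_⟩
      by_cases h : Z.card ≤ j
      · exact (hZ₁ Z h hfe).trans hle₂
      · obtain ⟨f, hf⟩ : Z.Nonempty := Finset.card_pos.1 (by omega)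
        have hsd : symmDiff (symmDiff G {f}) (Z.erase f) = symmDiff G Z := by
          rw [symmDiff_assoc]
          congr 1
          ext x
          simp only [Finset.mem_symmDiff, Finset.mem_singleton, Finset.mem_erase]
          by_cases hx : x = f
          · subst hx; simp [hf]
          · simp [hx]
        rw [← hsd] at hfe ⊢
        exact hZ₂ f f.2 _ (by rw [Finset.card_erase_of_mem hf]; omega) hfe

theorem improve_spec (L : ℕ) (hs : I.Loaded w s) (hbest : I.BestStored w s) :
    Runs I.oracle (improve L) s (30 * I.size + 30 + tryNearTime I.size L) fun s' =>
      I.BestStored w s' ∧ ∑ e ∈ I.marked 3 s, w e ≤ ∑ e ∈ I.marked 3 s', w e ∧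
      ∀ Z : Finset (Fin I.numEdges), Z.card ≤ L → I.Feasible (symmDiff (I.marked 3 s) Z) →
        ∑ e ∈ symmDiff (I.marked 3 s) Z, w e ≤ ∑ e ∈ I.marked 3 s', w e := by
  refine (copyEdges_spec I.oracle hs (by decide) (by decide) (by decide) (by decide)).seq
    fun s₁ ha h₁ => ?_
  have hs₁ : I.Loaded w s₁ := hs.agree ha (by simp [copyEdges, Program.writesNat])
    (by simp [copyEdges, Program.writesReal])
  have hn : s₁.nat 3 = s.nat 3 := ha.nat 3 (by simp [copyEdges, Program.writesNat])
  have hb₁ : I.BestStored w s₁ := hbest.congr hn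
    (ha.real 2 (by simp [copyEdges, Program.writesReal]))
  have h3 : I.marked 3 s₁ = I.marked 3 s := marked_congr fun e => by rw [hn]
  refine (tryNear_spec L hs₁ hb₁).mono le_rfl fun s' _ h => ⟨h.2.1, ?_, ?_⟩
  · rw [← h3]; exact h.2.2.1
  · rw [← h₁]; exact h.2.2.2

end MatchingInstance

/-! ### The approximation guarantee -/

open OracleRAM Program

/-- Bernoulli's inequality, squared, bounds the power with exponent `2 * (k + 1)` below by `((k + 1)
* δ) ^ 2`. This is quadratic in `k` and exceeds `4 * k + 5` once `k * δ ^ 2 ≥ 5`. -/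
theorem exists_growth_radius {δ : ℝ} (hδ : 0 < δ) :
    ∃ R : ℕ, 0 < R ∧ (2 * R + 1 : ℝ) ≤ (1 + δ) ^ R := by
  obtain ⟨k, hk⟩ := exists_nat_ge (5 / δ ^ 2)
  refine ⟨2 * (k + 1), by omega, ?_⟩
  have h1 : 1 + ((k + 1 : ℕ) : ℝ) * δ ≤ (1 + δ) ^ (k + 1) :=
    one_add_mul_le_pow (by linarith) _
  rw [div_le_iff₀ (by positivity)] at hk
  push_cast at h1 ⊢
  have h2 : ((k + 1 : ℝ) * δ) ^ 2 ≤ ((1 + δ) ^ (k + 1)) ^ 2 :=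
    pow_le_pow_left₀ (by positivity) (by linarith) 2
  rw [mul_comm 2 (k + 1), pow_mul]
  have hk0 : (0 : ℝ) ≤ k := Nat.cast_nonneg k
  nlinarith [mul_nonneg hk0 (sq_nonneg δ), sq_nonneg δ, mul_le_mul_of_nonneg_left hk hk0]

/-- With `u = 1/m`, the product `(1 - u) * (1 + u)` is at most 1, and Bernoulli's inequality bounds
`(1 + u) ^ (k * m)` below by `1 + k`. -/
theorem one_sub_inv_pow_le {m : ℕ} (hm : 0 < m) (k : ℕ) :
    (1 - (m : ℝ)⁻¹) ^ (k * m) ≤ ((1 : ℝ) + k)⁻¹ := by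
  have hm' : (1 : ℝ) ≤ m := by exact_mod_cast hm
  have hinv : (m : ℝ)⁻¹ ≤ 1 := inv_le_one_of_one_le₀ hm'
  have hpos : (0 : ℝ) < (m : ℝ)⁻¹ := by positivity
  have h1 : 1 + ((k * m : ℕ) : ℝ) * (m : ℝ)⁻¹ ≤ (1 + (m : ℝ)⁻¹) ^ (k * m) :=
    one_add_mul_le_pow (by linarith) _
  have h2 : 1 + ((k * m : ℕ) : ℝ) * (m : ℝ)⁻¹ = 1 + k := by
    push_cast
    field_simp
  rw [h2] at h1
  have h3 : (1 - (m : ℝ)⁻¹) ^ (k * m) * (1 + (m : ℝ)⁻¹) ^ (k * m) ≤ 1 := by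
    rw [← mul_pow]
    exact pow_le_one₀ (mul_nonneg (by linarith) (by linarith)) (by nlinarith)
  refine (le_div_iff₀ (by positivity)).2 ?_ |>.trans_eq (one_div _)
  exact (mul_le_mul_of_nonneg_left h1 (pow_nonneg (by linarith) _)).trans h3

namespace MatchingInstance

variable {I : MatchingInstance} {w : Fin I.numEdges → ℝ} {s : Memory}

/-- A time bound for the local search on instances of size `n`. -/
def localSearchTime (n L k : ℕ) : ℕ :=
  k * n * (30 * n + 30 + tryNearTime n L + (numEdgesExp.mulLit k).cost + 10) +
    ((numEdgesExp.mulLit k).cost + 10)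

/-- The invariant says that after `i` rounds all but a fraction `(1 - 1/m) ^ i` of `w(B)` is matched
up to the factor `1 + δ`. A round preserves it by averaging the old invariant, with weight `1 -
1/m`, and the local gain inequality, with weight `1/m`. -/
theorem localSearch_spec (hM : I.M.StronglyBaseOrderable) (hw : ∀ e, 0 ≤ w e) {δ : ℝ} (hδ : 0 < δ)
    {R k : ℕ} (hR : 0 < R) (hgrow : (2 * R + 1 : ℝ) ≤ (1 + δ) ^ R) (hk : 1 ≤ k * δ)
    (hs : I.Loaded w s) (h3 : I.marked 3 s = ∅) (hr : s.real 2 0 = 0) :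
    Runs I.oracle (localSearch (3 * (2 * R + 1)) k) s
      (localSearchTime I.size (3 * (2 * R + 1)) k) fun s' => I.Feasible (I.marked 3 s') ∧
        ∀ B, I.Feasible B → ∑ e ∈ B, w e ≤ (1 + δ) ^ 2 * ∑ e ∈ I.marked 3 s', w e := by
  set L := 3 * (2 * R + 1) with hL
  have h13 : ∀ a, (improve L).writesNat a → 3 ≤ a ∧ a ≠ 9 := by
    intro a h
    simp only [improve, copyEdges, Program.writesNat, writesNat_forLoop] at h
    rcases h with (h | h) | h
    · omega
    · omega
    · exact ⟨(writesNat_tryNear h).1, (writesNat_tryNear h).2.2⟩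
  have hwn : ∀ a, (localSearch L k).writesNat a → 3 ≤ a := by
    intro a h
    rw [localSearch, writesNat_forLoop] at h
    rcases h with h | h
    · omega
    · exact (h13 a h).1
  have hwr : ¬ (localSearch L k).writesReal 0 := by
    rw [localSearch, writesReal_forLoop]
    simp only [improve, copyEdges, Program.writesReal, writesReal_forLoop, false_or]
    exact fun h => writesReal_tryNear h rfl
  refine Runs.mono (Runs.forLoop (N := k * I.numEdges)
    (T := 30 * I.size + 30 + tryNearTime I.size L)
    (fun i s' => I.BestStored w s' ∧ ∀ B, I.Feasible B →
      (∑ e ∈ B, w e) * (1 - (1 - (I.numEdges : ℝ)⁻¹) ^ i) ≤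
        (1 + δ) * ∑ e ∈ I.marked 3 s', w e) (fun h => (h13 9 h).2 rfl) ?_ ?_ ?_) ?_ ?_
  · intro s' ha
    rw [NExp.eval_mulLit]
    exact congrArg _ (hs.agree ha hwn hwr).numEdges
  · have h3' : I.marked 3 (s.storeNat 9 0 0) = ∅ := by
      rw [← h3]
      exact marked_congr fun e => by simp
    refine ⟨⟨h3' ▸ I.feasible_empty, by rw [h3']; simpa using hr⟩, fun B _ => ?_⟩
    rw [h3']
    simp
  · rintro i hi s₁ ha - ⟨hb, hB⟩
    refine (improve_spec L (hs.agree ha hwn hwr) hb).mono le_rfl ?_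
    rintro s₂ - ⟨hb₂, hle, hloc⟩
    have h3₂ : I.marked 3 (s₂.storeNat 9 0 (i + 1)) = I.marked 3 s₂ :=
      marked_congr fun e => by simp
    refine ⟨hb₂.congr (by funext j; simp) rfl, fun B hBf => ?_⟩
    rw [h3₂]
    have hm : 0 < I.numEdges := Nat.pos_of_ne_zero fun h => by simp [h] at hi
    have hm' : (1 : ℝ) ≤ I.numEdges := by exact_mod_cast hm
    -- Here `g` is the actual gain of the round, which bounds the gain of every nearby feasible
    -- matching.
    have hgain := weight_le_of_local_gain hM hw hδ hR hgrow (sub_nonneg.2 hle) hb.feasible hBf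
      (fun Z hZ hf => by linarith [hloc Z hZ hf])
    have hq : 0 ≤ 1 - (I.numEdges : ℝ)⁻¹ := sub_nonneg.2 (inv_le_one_of_one_le₀ hm')
    have hold := mul_le_mul_of_nonneg_left (hB B hBf) hq
    have hinv : (0 : ℝ) ≤ (I.numEdges : ℝ)⁻¹ := by positivity
    have hnew := mul_le_mul_of_nonneg_left hgain hinv
    have hcancel : (I.numEdges : ℝ)⁻¹ * I.numEdges = 1 := inv_mul_cancel₀ (by positivity)
    rw [pow_succ]
    generalize (I.numEdges : ℝ)⁻¹ = u at *
    generalize (I.numEdges : ℝ) = m at *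
    generalize (1 - u) ^ i = q at *
    generalize ∑ e ∈ I.marked 3 s₁, w e = x at *
    generalize ∑ e ∈ I.marked 3 s₂, w e = y at *
    generalize ∑ e ∈ B, w e = z at *
    have e1 : u * ((1 + δ) * (x + m * (y - x))) = (1 + δ) * (u * x + (u * m) * (y - x)) := by ring
    rw [e1, hcancel] at hnew
    calc z * (1 - q * (1 - u)) = (1 - u) * (z * (1 - q)) + u * z := by ring
      _ ≤ (1 - u) * ((1 + δ) * x) + (1 + δ) * (u * x + 1 * (y - x)) := add_le_add hold hnew
      _ = (1 + δ) * y := by ring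
  · unfold localSearchTime
    gcongr
    simp [size]
  · rintro s' - ⟨hb, hB⟩
    refine ⟨hb.feasible, fun B hBf => ?_⟩
    have hx : 0 ≤ ∑ e ∈ I.marked 3 s', w e := Finset.sum_nonneg fun e _ => hw e
    have hz : 0 ≤ ∑ e ∈ B, w e := Finset.sum_nonneg fun e _ => hw e
    -- Without edges no round takes place and the invariant is trivial, so this case is settled by
    -- hand.
    rcases Nat.eq_zero_or_pos I.numEdges with h0 | hm
    · have : B = ∅ := Finset.eq_empty_of_forall_notMem fun e _ => by
        have := e.2; omega
      rw [this, Finset.sum_empty]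
      positivity
    have hpow := one_sub_inv_pow_le hm k
    have hfin := hB B hBf
    have hk0 : (0 : ℝ) < k := by
      by_contra h
      have : (k : ℝ) = 0 := le_antisymm (not_lt.1 h) (Nat.cast_nonneg k)
      rw [this] at hk
      linarith
    have h1 : (∑ e ∈ B, w e) * (1 - ((1 : ℝ) + k)⁻¹) ≤ (1 + δ) * ∑ e ∈ I.marked 3 s', w e :=
      (mul_le_mul_of_nonneg_left (by linarith) hz).trans hfin
    -- The left-over fraction is at most `1 / (1 + k)`, and `(1 + δ) * k / (1 + k) ≥ 1` is the same
    -- as `k * δ ≥ 1`.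
    have h2 : 1 ≤ (1 + δ) * (1 - ((1 : ℝ) + k)⁻¹) := by
      have : 1 - ((1 : ℝ) + k)⁻¹ = k / (1 + k) := by field_simp; ring
      rw [this, ← mul_div_assoc, le_div_iff₀ (by positivity)]
      linarith
    calc ∑ e ∈ B, w e ≤ (∑ e ∈ B, w e) * ((1 + δ) * (1 - ((1 : ℝ) + k)⁻¹)) :=
          le_mul_of_one_le_right hz h2
      _ = (1 + δ) * ((∑ e ∈ B, w e) * (1 - ((1 : ℝ) + k)⁻¹)) := by ring
      _ ≤ (1 + δ) * ((1 + δ) * ∑ e ∈ I.marked 3 s', w e) :=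
          mul_le_mul_of_nonneg_left h1 (by linarith)
      _ = _ := by ring

/-! ### Unit weights and polynomial time bounds -/

theorem unitWeights_spec (O : Set ℕ → Prop) (hs : I.Loaded w s) :
    Runs O unitWeights s (30 * I.size + 30) fun s' => I.Loaded (fun _ => 1) s' := by
  refine Runs.mono (Q := fun s' => ∀ e : Fin I.numEdges, (e : ℕ) < I.numEdges → s'.real 0 e = 1)
    (Runs.forLoop (N := I.numEdges) (T := 8)
    (fun i s' => ∀ e : Fin I.numEdges, (e : ℕ) < i → s'.real 0 e = 1) ?_ ?_ ?_ ?_) ?_ ?_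
  · simp [Program.writesNat]
  · intro s' ha
    simp only [numEdgesExp, NExp.eval]
    rw [ha.nat 0 (by simp [Program.writesNat]), hs.numEdges]
  · simp
  · intro i hi s' ha hc hinv
    refine (Runs.setReal ?_).mono (by simp [NExp.cost, RExp.cost, counter]) fun _ _ h => h
    intro e he
    simp [counter, NExp.eval, RExp.eval, hc]
    intro h
    exact hinv e (by omega)
  · simp only [numEdgesExp, NExp.cost, size]
    omega
  · intro s' ha h
    have hn : ∀ a < 3, s'.nat a = s.nat a := fun a h3 =>
      ha.nat a (by simp [unitWeights, Program.writesNat]; omega)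
    exact ⟨by rw [hn 0 (by omega), hs.numElts], by rw [hn 0 (by omega), hs.numEdges],
      fun e => by rw [hn 1 (by omega), hs.fst], fun e => by rw [hn 2 (by omega), hs.snd],
      fun e => h e e.2⟩

/-- Each level of nesting multiplies the bound by about `n`, so the degree grows with `j`. It stays
fixed because `j` will depend on `ε` alone. -/
theorem exists_polynomial_tryNearTime (j : ℕ) :
    ∃ p : Polynomial ℕ, ∀ n, p.eval n = tryNearTime n j := by
  induction j with
  | zero => exact ⟨200 * .X + 200, fun n => by simp [tryNearTime]⟩
  | succ j ih =>
    obtain ⟨p, hp⟩ := ih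
    exact ⟨p + (.X * (p + 50) + 50), fun n => by simp [tryNearTime, hp]⟩

theorem exists_polynomial_localSearchTime (L k : ℕ) :
    ∃ p : Polynomial ℕ, ∀ n, p.eval n = localSearchTime n L k := by
  obtain ⟨p, hp⟩ := exists_polynomial_tryNearTime L
  exact ⟨.C k * .X * (30 * .X + 30 + p + .C (numEdgesExp.mulLit k).cost + 10) +
    (.C (numEdgesExp.mulLit k).cost + 10), fun n => by simp [localSearchTime, hp]⟩

end MatchingInstance

/-- The parameters of the local search for a given precision. -/
theorem exists_localSearch_parameters {ε : ℝ} (hε : 0 < ε) :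
    ∃ (δ : ℝ) (R k : ℕ), 0 < δ ∧ (1 + δ) ^ 2 = 1 + ε ∧ 0 < R ∧
      (2 * R + 1 : ℝ) ≤ (1 + δ) ^ R ∧ 1 ≤ k * δ := by
  -- One factor `1 + δ` is lost to the light layers and one to stopping early; this `δ` makes their
  -- product equal to `1 + ε`.
  have hδ : 0 < √(1 + ε) - 1 := by
    rw [sub_pos, Real.lt_sqrt (by norm_num)]
    linarith
  obtain ⟨R, hR, hgrow⟩ := exists_growth_radius hδ
  obtain ⟨k, hk⟩ := exists_nat_ge (1 / (√(1 + ε) - 1))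
  refine ⟨√(1 + ε) - 1, R, k, hδ, ?_, hR, hgrow, (div_le_iff₀ hδ).1 hk⟩
  rw [add_sub_cancel, Real.sq_sqrt (by linarith)]

theorem mainTheorem3 :
    (∀ ε : ℝ, 0 < ε → ∃ P : OracleRAM.Program, WeightedApproxInPolyTime ε P) ∧
    (∀ ε : ℝ, 0 < ε → ∃ P : OracleRAM.Program, UnweightedApproxInPolyTime ε P) := by
  constructor
  · intro ε hε
    obtain ⟨δ, R, k, hδ, hδε, hR, hgrow, hk⟩ := exists_localSearch_parameters hε
    obtain ⟨p, hp⟩ := MatchingInstance.exists_polynomial_localSearchTime (3 * (2 * R + 1)) k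
    refine ⟨localSearch (3 * (2 * R + 1)) k, p, fun I hM w hw => ?_⟩
    obtain ⟨t, s, hex, ht, hfeas, happ⟩ := MatchingInstance.localSearch_spec hM hw hδ hR hgrow hk
      (I.loaded_input w) (by simp [MatchingInstance.marked, MatchingInstance.input])
      (by simp [MatchingInstance.input])
    -- `I.output s` unfolds to `I.marked 3 s`.
    exact ⟨t, s, hex, by rwa [hp], hfeas, fun B hB => hδε ▸ happ B hB⟩
  · intro ε hε
    obtain ⟨δ, R, k, hδ, hδε, hR, hgrow, hk⟩ := exists_localSearch_parameters hε
    obtain ⟨p, hp⟩ := MatchingInstance.exists_polynomial_localSearchTime (3 * (2 * R + 1)) k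
    refine ⟨.seq unitWeights (localSearch (3 * (2 * R + 1)) k), 30 * .X + 30 + p,
      fun I hM => ?_⟩
    obtain ⟨t, s, hex, ht, hfeas, happ⟩ :=
      -- The start memory holds only zero weights here, so the program writes unit weights itself;
      -- cardinality is then weight.
      (MatchingInstance.unitWeights_spec I.oracle (I.loaded_input fun _ => 0)).seq
        fun s' ha hs' => MatchingInstance.localSearch_spec hM (fun _ => zero_le_one) hδ hR hgrow hk
          hs' (by
            have h3 := ha.nat 3 (by simp [unitWeights, Program.writesNat])
            simp [MatchingInstance.marked, h3, MatchingInstance.input]) (by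
            have h2 := ha.real 2 (by simp [unitWeights, Program.writesReal])
            simp [h2, MatchingInstance.input])
    refine ⟨t, s, hex, by simpa [hp] using ht, hfeas, fun B hB => ?_⟩
    have := happ B hB
    rw [hδε] at this
    simpa [MatchingInstance.output, MatchingInstance.marked] using this
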